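/- Let $M$ be a nonempty finite-dimensional smooth manifold with a Riemannian metric $m=\langle\,,\rangle$, let $\pi:TM\to M$ be the projection, and let the Lagrange forms on $TM$ be $\theta_w(Y)=\langle w,T\pi(Y)\rangle$ ($w\in TM$, $Y\in T_w(TM)$) and $\sigma=d\theta$. Let a one-dimensional Lie group $G=\{g^\tau:\tau\in\mathbb R\}$, the image of a smooth homomorphism $\tau\mapsto g^\tau$ from $\mathbb R$, act smoothly on $M$ by isometries of $m$, and suppose that this action makes $p:M\to\widetilde M=M/G$ a smooth principal $G$-bundle. Let $v(x)=\frac{d}{d\tau}\big|_{\tau=0}g^\tau(x)$ be the generating vector field, $J:TM\to\mathbb R$, $J(w)=\langle v,w\rangle$, the momentum, and let $k\in\mathbb R$. Then $J$ is smooth and $dJ$ vanishes nowhere, so $J_k=J^{-1}(k)$ is a submanifold of $TM$ with $T_wJ_k=\ker dJ_w$. Let $\theta^k$ and $\sigma^k$ be the forms induced on $J_k$ by $\theta$ and $\sigma$ (the pull-backs under the inclusion $J_k\subset TM$), and let $\rho_k:J_k\to T\widetilde M$ be the restriction of $Tp:TM\to T\widetilde M$. A form on $J_k$ is called horizontal for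 the bundle $\rho_k:J_k\to T\widetilde M$ if it vanishes whenever one of its arguments lies in $\ker T\rho_k$. Then: 1. $J_k$ is invariant under the group $G_T=\{Tg^\tau\}$, and $\theta^k$ and $\sigma^k$ are preserved by $G_T$; 2. $\sigma^k$ is horizontal for the bundle $\rho_k:J_k\to T\widetilde M$; 3. $\theta^k$ is horizontal for this bundle if and only if $k=0$. -/

import Mathlib

open Bundle Set Function
open scoped Manifold ContDiff Topology

noncomputable section

namespace MomentumLevel

/-! ### Differential forms and the exterior derivative on a manifold -/

section Forms

variable {E : Type*} [NormedAddCommGroup E] [NormedSpace ℝ E]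
  {H : Type*} [TopologicalSpace H] (I : ModelWithCorners ℝ E H)
  {N : Type*} [TopologicalSpace N] [ChartedSpace H N]

/-- A (not necessarily smooth) real differential form of degree `j` on `N`: an alternating
`j`-linear form on every tangent space. -/
abbrev DiffForm (N : Type*) [TopologicalSpace N] [ChartedSpace H N] (j : ℕ) :=
  (x : N) → (TangentSpace I x) [⋀^Fin j]→L[ℝ] ℝ

/-- The exterior derivative of a form on a manifold: write the form in the preferred chart around
`x` (pull it back by the inverse of the chart), take the exterior derivative in the model vector
space, and pull the result back by the chart. -/
def extDerivForm {j : ℕ} (α : DiffForm I N j) : DiffForm I N (j + 1) := fun x =>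
  (extDerivWithin (fun y : E =>
      (α ((extChartAt I x).symm y)).compContinuousLinearMap
        (mfderivWithin 𝓘(ℝ, E) I (extChartAt I x).symm (range I) y))
    (range I) (extChartAt I x x)).compContinuousLinearMap
      (mfderiv I 𝓘(ℝ, E) (extChartAt I x) x)

end Forms

/-! ### Lagrange forms of a Riemannian metric -/

section Lagrange

variable {E : Type*} [NormedAddCommGroup E] [NormedSpace ℝ E]
  {M : Type*} [TopologicalSpace M] [ChartedSpace E M] [IsManifold 𝓘(ℝ, E) ∞ M]

/-- Smooth Riemannian metrics on `M`. -/
abbrev Metric (E : Type*) [NormedAddCommGroup E] [NormedSpace ℝ E]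
    (M : Type*) [TopologicalSpace M] [ChartedSpace E M] [IsManifold 𝓘(ℝ, E) ∞ M] :=
  ContMDiffRiemannianMetric 𝓘(ℝ, E) ∞ E (fun x : M => TangentSpace 𝓘(ℝ, E) x)

/-- The first Lagrange form on `TM`: `θ_w(Y) = ⟨w, Tπ(Y)⟩`, with `π : TM → M` the projection. -/
def lagrangeOneForm (m : Metric E M) :
    DiffForm (𝓘(ℝ, E).tangent) (TangentBundle 𝓘(ℝ, E) M) 1 := fun w =>
  ContinuousAlternatingMap.ofSubsingleton ℝ (TangentSpace (𝓘(ℝ, E).tangent) w) ℝ (0 : Fin 1)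
    ((m.inner w.proj w.snd).comp
      (mfderiv (𝓘(ℝ, E).tangent) 𝓘(ℝ, E)
        (fun u : TangentBundle 𝓘(ℝ, E) M => u.proj) w))

/-- The second Lagrange form on `TM`: `σ = dθ`. -/
def lagrangeTwoForm (m : Metric E M) :
    DiffForm (𝓘(ℝ, E).tangent) (TangentBundle 𝓘(ℝ, E) M) 2 :=
  extDerivForm (𝓘(ℝ, E).tangent) (lagrangeOneForm m)

end Lagrange

/-! ### One-parameter groups and principal bundles -/

section Action

variable {E : Type*} [NormedAddCommGroup E] [NormedSpace ℝ E]
  {E' : Type*} [NormedAddCommGroup E'] [NormedSpace ℝ E']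
  {M : Type*} [TopologicalSpace M] [ChartedSpace E M]
  {M' : Type*} [TopologicalSpace M'] [ChartedSpace E' M']
  {G : Type*} [TopologicalSpace G] [ChartedSpace ℝ G] [Group G] [MulAction G M]

/-- `γ` is a smooth homomorphism of `(ℝ, +)` onto the Lie group `G`, so that `G = {γ τ}` is a
one-parameter group; the Lie group `G` being modelled on `ℝ`, it is a line or a circle. -/
structure IsOneParameterGroup (γ : ℝ → G) : Prop where
  map_add : ∀ s t : ℝ, γ (s + t) = γ s * γ t
  contMDiff : ContMDiff 𝓘(ℝ, ℝ) 𝓘(ℝ, ℝ) ∞ γ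
  surjective : Surjective γ

variable (E E' G) in
/-- `p : M → M'` is a (smooth) principal `G`-bundle for the given action of `G` on `M`: every point
of `M'` has an open neighbourhood `U` over which there is a diffeomorphism `p⁻¹(U) ≃ U × G` over
`U` that turns the action into left translation of the second factor. In particular `p` is a
surjective submersion, the action is free, and the fibres of `p` are the orbits, so `M' = M / G`. -/
def IsPrincipalBundle (p : M → M') : Prop :=
  ∀ y : M', ∃ (U : Set M') (e : OpenPartialHomeomorph M (M' × G)),
    IsOpen U ∧ y ∈ U ∧ e.source = p ⁻¹' U ∧ e.target = U ×ˢ (univ : Set G) ∧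
    ContMDiffOn 𝓘(ℝ, E) (𝓘(ℝ, E').prod 𝓘(ℝ, ℝ)) ∞ e e.source ∧
    ContMDiffOn (𝓘(ℝ, E').prod 𝓘(ℝ, ℝ)) 𝓘(ℝ, E) ∞ e.symm e.target ∧
    (∀ x ∈ e.source, (e x).1 = p x) ∧
    (∀ (h : G), ∀ x ∈ e.source, h • x ∈ e.source ∧ e (h • x) = ((e x).1, h * (e x).2))

/-- The generating vector field `v(x) = d/dτ|₀ (γ τ • x)`. (The derivative is a tangent vector
at `γ 0 • x`, which is the point `x`.) -/
def generator (γ : ℝ → G) (x : M) : TangentSpace 𝓘(ℝ, E) x :=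
  (mfderiv 𝓘(ℝ, ℝ) 𝓘(ℝ, E) (fun τ : ℝ => γ τ • x) 0 (1 : ℝ) :
    TangentSpace 𝓘(ℝ, E) (γ 0 • x))

variable (E M) in
/-- The action of `h ∈ G` on `TM`, i.e. the tangent map of `x ↦ h • x`. -/
def tangentAction (h : G) : TangentBundle 𝓘(ℝ, E) M → TangentBundle 𝓘(ℝ, E) M :=
  tangentMap 𝓘(ℝ, E) 𝓘(ℝ, E) (fun x : M => h • x)

variable [IsManifold 𝓘(ℝ, E) ∞ M]

/-- Every `h ∈ G` acts by isometries of `m`. -/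
def ActsByIsometries (G : Type*) [Group G] [MulAction G M] (m : Metric E M) : Prop :=
  ∀ (h : G) (x : M) (u w : TangentSpace 𝓘(ℝ, E) x),
    m.inner (h • x) (mfderiv 𝓘(ℝ, E) 𝓘(ℝ, E) (fun z : M => h • z) x u)
      (mfderiv 𝓘(ℝ, E) 𝓘(ℝ, E) (fun z : M => h • z) x w) = m.inner x u w

/-- The momentum `J(w) = ⟨v, w⟩`. -/
def momentum (m : Metric E M) (γ : ℝ → G) (w : TangentBundle 𝓘(ℝ, E) M) : ℝ :=
  m.inner w.proj (generator γ w.proj) w.snd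

end Action

/-! ### Level sets and induced forms -/

section Level

variable {E : Type*} [NormedAddCommGroup E] [NormedSpace ℝ E]
  {H : Type*} [TopologicalSpace H] (I : ModelWithCorners ℝ E H)
  {F : Type*} [NormedAddCommGroup F] [NormedSpace ℝ F]
  {H₁ : Type*} [TopologicalSpace H₁] (I₁ : ModelWithCorners ℝ F H₁)
  {N : Type*} [TopologicalSpace N] [ChartedSpace H N]
  {P : Type*} [TopologicalSpace P] [ChartedSpace H₁ P]

/-- The level set `J⁻¹(k)`. -/
def Level (J : N → ℝ) (k : ℝ) : Set N := {w | J w = k}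

/-- The tangent space at `w` of the level of `J` through `w`, as a subspace of `T_w N`: the kernel
of `dJ_w` (for `J` smooth with nowhere vanishing differential). -/
def levelTangent (J : N → ℝ) (w : N) : Submodule ℝ (TangentSpace I w) :=
  LinearMap.ker (mfderiv I 𝓘(ℝ, ℝ) J w).toLinearMap

/-- Differential forms of degree `j` on the level `J⁻¹(k)`. -/
abbrev LevelForm (J : N → ℝ) (k : ℝ) (j : ℕ) :=
  (w : Level J k) → (levelTangent I J w.1) [⋀^Fin j]→L[ℝ] ℝ

/-- The form induced on `J⁻¹(k)` by a form on `N` (the pull-back by the inclusion). -/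
def inducedForm (J : N → ℝ) (k : ℝ) {j : ℕ} (α : DiffForm I N j) : LevelForm I J k j := fun w =>
  (α w.1).compContinuousLinearMap (levelTangent I J w.1).subtypeL

/-- A form `α` on `J⁻¹(k)` is preserved by the map `f : N → N`: `f` maps the level into itself, the
tangent map of `f` maps tangent vectors of the level to tangent vectors of the level, and `f^* α = α`
on the level. -/
def IsPreservedBy (J : N → ℝ) (k : ℝ) {j : ℕ} (α : LevelForm I J k j) (f : N → N) : Prop :=
  ∀ w : Level J k, ∃ (hw : f w.1 ∈ Level J k)
    (hT : ∀ Y ∈ levelTangent I J w.1, mfderiv I I f w.1 Y ∈ levelTangent I J (f w.1)),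
    (α ⟨f w.1, hw⟩).compContinuousLinearMap ((mfderiv I I f w.1).restrict hT) = α w

/-- For `q : N → P`, the differential at `w` of the restriction of `q` to the level `J⁻¹(k)`. -/
def levelDeriv (J : N → ℝ) (q : N → P) (w : N) :
    levelTangent I J w →L[ℝ] TangentSpace I₁ (q w) :=
  (mfderiv I I₁ q w).comp (levelTangent I J w).subtypeL

/-- A form on `J⁻¹(k)` is horizontal for the bundle `q : J⁻¹(k) → P` (the restriction of
`q : N → P`): it vanishes as soon as one of its arguments is vertical, i.e. is killed by the
differential of the bundle projection. -/
def IsHorizontal (J : N → ℝ) (k : ℝ) {j : ℕ} (α : LevelForm I J k j) (q : N → P) : Prop :=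
  ∀ (w : Level J k) (Y : Fin j → levelTangent I J w.1),
    (∃ i, levelDeriv I I₁ J q w.1 (Y i) = 0) → α w Y = 0

end Level

end MomentumLevel

end

set_option maxSynthPendingDepth 3
set_option linter.unusedSectionVars false

noncomputable section

namespace MomentumLevel

/-! ### Calculus in a vector space: Killing equation, lifts of a vector field, the local two-form.
-/

section Calculus

/-! In the chart of `TM` induced by a chart of `M`, a point is `(x, u)`, the one-form is `θ(a, b) =
g_x(u, a)` and the momentum is `J = g_x(V, u)`, where `V` is the local generating field. Two lifts
of `V` to `TM` matter: the complete lift `Vᶜ = (V, DV·u)`, which generates the action on `TM`, and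
the vertical lift `(0, V)`.

Isometry of the flow gives the Killing equation (`killing_of_isometries`). Its consequences are
`dJ(Vᶜ) = 0` and `σ(Vᶜ, ·) = -dJ`. The action is free and the group is not a point, so `V` has no
zeros (`IsOneParameterGroup.generator_ne_zero`); hence `dJ(0, V) = g(V, V) > 0`, and every level of
`J` is regular.

As `V` spans the kernel of `Tp`, the two lifts span the kernel of `T(Tp)`
(`exists_of_fderiv_tangentExpr_eq_zero`). A combination `c Vᶜ + d (0, V)` is tangent to the level
only if `d = 0`, so the vertical vectors of `J_k → TM'` are the multiples of `Vᶜ`. On them `σ`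
contracts to a multiple of `dJ`, which is zero on the level (`extDeriv_lagrangeExpr_completeLift`),
whereas `θ(Vᶜ) = g(u, V) = J = k`. This gives both horizontality statements.

Invariance is formal. The group is commutative, so `V` is invariant and so is `J`. Isometries
preserve `θ`, and they preserve `σ = dθ` because the exterior derivative commutes with pull-back
(`pullbackForm_extDerivForm`). -/

theorem two_le_infty : (2 : WithTop ℕ∞) ≤ ∞ := ENat.LEInfty.out

theorem one_add_one_le_infty : (1 + 1 : WithTop ℕ∞) ≤ ∞ := by
  rw [one_add_one_eq_two]; exact two_le_infty

variable {E : Type*} [NormedAddCommGroup E] [NormedSpace ℝ E]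
  {E' : Type*} [NormedAddCommGroup E'] [NormedSpace ℝ E']

/-- The velocity field at time `0` of a family of maps `F τ : E → E`. -/
def initialVelocity (F : ℝ × E → E) (z : E) : E := fderiv ℝ F (0, z) (1, 0)

theorem hasFDerivAt_initialVelocity {F : ℝ × E → E} {z : E} (hF : ContDiffAt ℝ ∞ F (0, z)) :
    HasFDerivAt (initialVelocity F)
      ((ContinuousLinearMap.apply ℝ E ((1 : ℝ), (0 : E))).comp
        ((fderiv ℝ (fderiv ℝ F) (0, z)).comp (ContinuousLinearMap.inr ℝ ℝ E))) z := by
  have h2 : DifferentiableAt ℝ (fderiv ℝ F) (0, z) :=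
    (hF.fderiv_right (m := 1) one_add_one_le_infty).differentiableAt (by simp)
  have h3 : HasFDerivAt (fun z : E => ((0 : ℝ), z)) (ContinuousLinearMap.inr ℝ ℝ E) z :=
    hasFDerivAt_prodMk_right _ _
  exact (ContinuousLinearMap.apply ℝ E ((1 : ℝ), (0 : E))).hasFDerivAt.comp z
    (h2.hasFDerivAt.comp z h3)

/-- The Killing equation for a one-parameter family of isometries. -/
theorem killing_of_isometries {F : ℝ × E → E} {z : E} (hF : ContDiffAt ℝ ∞ F (0, z))
    (h0 : ∀ᶠ y in 𝓝 z, F (0, y) = y) {g : E → E →L[ℝ] E →L[ℝ] ℝ} (hg : DifferentiableAt ℝ g z)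
    (hiso : ∀ a b : E, ∀ᶠ τ : ℝ in 𝓝 0,
      g (F (τ, z)) (fderiv ℝ F (τ, z) (0, a)) (fderiv ℝ F (τ, z) (0, b)) = g z a b) (a b : E) :
    fderiv ℝ g z (initialVelocity F z) a b + g z (fderiv ℝ (initialVelocity F) z a) b
      + g z a (fderiv ℝ (initialVelocity F) z b) = 0 := by
  have h2 : DifferentiableAt ℝ (fderiv ℝ F) (0, z) :=
    (hF.fderiv_right (m := 1) one_add_one_le_infty).differentiableAt (by simp)
  have hsymm : IsSymmSndFDerivAt ℝ F (0, z) := hF.isSymmSndFDerivAt (by simpa using two_le_infty)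
  have hz : F (0, z) = z := h0.self_of_nhds
  have hline : HasDerivAt (fun τ : ℝ => (τ, z)) ((1 : ℝ), (0 : E)) 0 :=
    (hasDerivAt_id _).prodMk (hasDerivAt_const _ _)
  have hFd : HasDerivAt (fun τ : ℝ => F (τ, z)) (initialVelocity F z) 0 :=
    (hF.differentiableAt (by simp)).hasFDerivAt.comp_hasDerivAt 0 hline
  -- Symmetry of the second derivative exchanges the time derivative at `0` with the space
  -- derivative: `D(∂_τ F) = ∂_τ(DF)`.
  have hV : ∀ a : E, fderiv ℝ (initialVelocity F) z a
      = fderiv ℝ (fderiv ℝ F) (0, z) (1, 0) (0, a) := by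
    intro a
    rw [(hasFDerivAt_initialVelocity hF).fderiv, hsymm.eq]
    rfl
  have hD : ∀ a : E, HasDerivAt (fun τ : ℝ => fderiv ℝ F (τ, z) (0, a))
      (fderiv ℝ (initialVelocity F) z a) 0 := by
    intro a
    rw [hV]
    have := h2.hasFDerivAt.comp_hasDerivAt (0 : ℝ) hline
    exact this.clm_apply (hasDerivAt_const _ _) |>.congr_deriv (by simp)
  have hid : ∀ a : E, fderiv ℝ F (0, z) (0, a) = a := by
    intro a
    have h1 : HasFDerivAt (fun y : E => F (0, y))
        ((fderiv ℝ F (0, z)).comp (ContinuousLinearMap.inr ℝ ℝ E)) z :=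
      (hF.differentiableAt (by simp)).hasFDerivAt.comp z (hasFDerivAt_prodMk_right _ _)
    have h2 : HasFDerivAt (fun y : E => F (0, y)) (ContinuousLinearMap.id ℝ E) z :=
      (hasFDerivAt_id z).congr_of_eventuallyEq h0
    have := congrArg (fun L : E →L[ℝ] E => L a) (h1.unique h2)
    simpa using this
  have hgF : HasDerivAt (fun τ : ℝ => g (F (τ, z))) (fderiv ℝ g z (initialVelocity F z)) 0 := by
    have hg' : HasFDerivAt g (fderiv ℝ g z) (F (0, z)) := by rw [hz]; exact hg.hasFDerivAt
    exact hg'.comp_hasDerivAt (0 : ℝ) hFd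
  -- The product rule at `τ = 0` for the function `hiso` declares constant; its three terms are
  -- those of the Killing equation.
  have h1 := (hgF.clm_apply (hD a)).clm_apply (hD b)
  have h3 : HasDerivAt (fun τ : ℝ => g (F (τ, z)) (fderiv ℝ F (τ, z) (0, a))
      (fderiv ℝ F (τ, z) (0, b))) 0 0 :=
    (hasDerivAt_const (0 : ℝ) (g z a b)).congr_of_eventuallyEq (hiso a b)
  have h4 := h1.unique h3
  simpa [hid, hz] using h4

/-- The local expression of the tangent map of `P`. -/
def tangentExpr (P : E → E') (q : E × E) : E' × E' := (P q.1, fderiv ℝ P q.1 q.2)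

theorem hasFDerivAt_tangentExpr {P : E → E'} {q : E × E} (hP : ContDiffAt ℝ ∞ P q.1) :
    HasFDerivAt (tangentExpr P)
      (((fderiv ℝ P q.1).comp (ContinuousLinearMap.fst ℝ E E)).prod
        ((fderiv ℝ P q.1).comp (ContinuousLinearMap.snd ℝ E E) +
          ((fderiv ℝ (fderiv ℝ P) q.1).comp (ContinuousLinearMap.fst ℝ E E)).flip q.2)) q := by
  have h2 : DifferentiableAt ℝ (fderiv ℝ P) q.1 :=
    (hP.fderiv_right (m := 1) one_add_one_le_infty).differentiableAt (by simp)
  refine HasFDerivAt.prodMk ?_ ?_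
  · exact (hP.differentiableAt (by simp)).hasFDerivAt.comp q hasFDerivAt_fst
  · exact (h2.hasFDerivAt.comp q hasFDerivAt_fst).clm_apply hasFDerivAt_snd

theorem fderiv_tangentExpr_apply {P : E → E'} {q : E × E} (hP : ContDiffAt ℝ ∞ P q.1)
    (Y : E × E) :
    fderiv ℝ (tangentExpr P) q Y =
      (fderiv ℝ P q.1 Y.1, fderiv ℝ P q.1 Y.2 + fderiv ℝ (fderiv ℝ P) q.1 Y.1 q.2) := by
  rw [(hasFDerivAt_tangentExpr hP).fderiv]
  simp

/-- If the vector field `V` is vertical for `P`, so is its complete lift for the tangent map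
of `P`. -/
theorem snd_fderiv_apply_vertical {P : E → E'} {V : E → E} {x : E} (hP : ContDiffAt ℝ ∞ P x)
    (hV : DifferentiableAt ℝ V x) (hPV : ∀ᶠ y in 𝓝 x, fderiv ℝ P y (V y) = 0) (u : E) :
    fderiv ℝ P x (fderiv ℝ V x u) + fderiv ℝ (fderiv ℝ P) x (V x) u = 0 := by
  have h2 : DifferentiableAt ℝ (fderiv ℝ P) x :=
    (hP.fderiv_right (m := 1) one_add_one_le_infty).differentiableAt (by simp)
  have hsymm : IsSymmSndFDerivAt ℝ P x := hP.isSymmSndFDerivAt (by simpa using two_le_infty)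
  -- Differentiating `DP(V) = 0` along `u` gives the claim with the arguments of the second
  -- derivative in the other order.
  have h1 := h2.hasFDerivAt.clm_apply hV.hasFDerivAt
  have h3 : HasFDerivAt (fun y => fderiv ℝ P y (V y)) (0 : E →L[ℝ] E') x :=
    (hasFDerivAt_const (0 : E') x).congr_of_eventuallyEq hPV
  have h4 := congrArg (fun L : E →L[ℝ] E' => L u) (h1.unique h3)
  rw [hsymm.eq]
  simpa using h4

theorem fderiv_tangentExpr_completeLift {P : E → E'} {V : E → E} {x : E}
    (hP : ContDiffAt ℝ ∞ P x) (hV : DifferentiableAt ℝ V x)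
    (hPV : ∀ᶠ y in 𝓝 x, fderiv ℝ P y (V y) = 0) (u : E) :
    fderiv ℝ (tangentExpr P) (x, u) (V x, fderiv ℝ V x u) = 0 := by
  rw [fderiv_tangentExpr_apply (q := (x, u)) hP]
  exact Prod.ext hPV.self_of_nhds (snd_fderiv_apply_vertical hP hV hPV u)

/-- The kernel of the differential of the tangent map of `P`, when the kernel of the differential of
`P` is spanned by `V`, consists of combinations of the complete and the vertical lift of `V`. -/
theorem exists_of_fderiv_tangentExpr_eq_zero {P : E → E'} {V : E → E} {x : E}
    (hP : ContDiffAt ℝ ∞ P x) (hV : DifferentiableAt ℝ V x)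
    (hPV : ∀ᶠ y in 𝓝 x, fderiv ℝ P y (V y) = 0)
    (hker : ∀ a, fderiv ℝ P x a = 0 → ∃ c : ℝ, a = c • V x) {u : E} {Y : E × E}
    (hY : fderiv ℝ (tangentExpr P) (x, u) Y = 0) :
    ∃ c d : ℝ, Y = (c • V x, c • fderiv ℝ V x u + d • V x) := by
  rw [fderiv_tangentExpr_apply (q := (x, u)) hP] at hY
  obtain ⟨h1, h2⟩ := Prod.ext_iff.1 hY
  obtain ⟨c, hc⟩ := hker _ h1
  have h3 := snd_fderiv_apply_vertical hP hV hPV u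
  -- Once `c` times the complete lift is subtracted from `Y`, the fibre component left over is
  -- killed by `DP`: the second-derivative terms of `h2` and `h3` cancel.
  obtain ⟨d, hd⟩ := hker (Y.2 - c • fderiv ℝ V x u) (by
    have h2' : fderiv ℝ P x Y.2 + fderiv ℝ (fderiv ℝ P) x Y.1 u = 0 := h2
    rw [hc] at h2'
    simp only [map_smul, smul_apply, map_sub] at h2' ⊢
    rw [eq_neg_of_add_eq_zero_left h2', eq_neg_of_add_eq_zero_left h3]
    simp)
  exact ⟨c, d, Prod.ext hc (by rw [← hd]; simp)⟩

/-- The local expression of the first Lagrange form of the metric `g`. -/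
def lagrangeExpr (g : E → E →L[ℝ] E →L[ℝ] ℝ) (q : E × E) : (E × E) [⋀^Fin 1]→L[ℝ] ℝ :=
  ContinuousAlternatingMap.ofSubsingleton ℝ (E × E) ℝ (0 : Fin 1)
    ((g q.1 q.2).comp (ContinuousLinearMap.fst ℝ E E))

/-- The local expression of the momentum of the vector field `V`. -/
def momentumExpr (g : E → E →L[ℝ] E →L[ℝ] ℝ) (V : E → E) (q : E × E) : ℝ := g q.1 (V q.1) q.2

theorem fderiv_momentumExpr_apply {g : E → E →L[ℝ] E →L[ℝ] ℝ} {V : E → E} {q : E × E}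
    (hg : DifferentiableAt ℝ g q.1) (hV : DifferentiableAt ℝ V q.1) (Y : E × E) :
    fderiv ℝ (momentumExpr g V) q Y = fderiv ℝ g q.1 Y.1 (V q.1) q.2
      + g q.1 (fderiv ℝ V q.1 Y.1) q.2 + g q.1 (V q.1) Y.2 := by
  have h := ((hg.hasFDerivAt.comp q hasFDerivAt_fst).clm_apply
    (hV.hasFDerivAt.comp q hasFDerivAt_fst)).clm_apply hasFDerivAt_snd
  have h' : HasFDerivAt (momentumExpr g V) _ q := h
  rw [h'.fderiv]
  simp
  ring

/-- `J` is linear in the fibre coordinate. With `b = V x` the value is `g(V, V)`, whose positivity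
makes the levels regular. -/
theorem fderiv_momentumExpr_vertical {g : E → E →L[ℝ] E →L[ℝ] ℝ} {V : E → E} {x u : E}
    (hg : DifferentiableAt ℝ g x) (hV : DifferentiableAt ℝ V x) (b : E) :
    fderiv ℝ (momentumExpr g V) (x, u) (0, b) = g x (V x) b := by
  rw [fderiv_momentumExpr_apply (q := (x, u)) hg hV]
  simp

theorem differentiableAt_lagrangeExpr {g : E → E →L[ℝ] E →L[ℝ] ℝ} {q : E × E}
    (hg : DifferentiableAt ℝ g q.1) : DifferentiableAt ℝ (lagrangeExpr g) q := by
  have h : DifferentiableAt ℝ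
      (fun q : E × E => (g q.1 q.2).comp (ContinuousLinearMap.fst ℝ E E)) q :=
    (((hg.hasFDerivAt.comp q hasFDerivAt_fst).clm_apply
      hasFDerivAt_snd).differentiableAt).clm_comp (differentiableAt_const _)
  exact (ContinuousAlternatingMap.ofSubsingletonLIE (𝕜 := ℝ) (E := E × E) (F := ℝ)
    (0 : Fin 1)).toContinuousLinearEquiv.differentiableAt.comp q h

theorem extDeriv_lagrangeExpr_apply {g : E → E →L[ℝ] E →L[ℝ] ℝ} {q : E × E}
    (hg : DifferentiableAt ℝ g q.1) (Y : Fin 2 → E × E) :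
    extDeriv (lagrangeExpr g) q Y =
      (fderiv ℝ g q.1 (Y 0).1 q.2 (Y 1).1 + g q.1 (Y 0).2 (Y 1).1)
      - (fderiv ℝ g q.1 (Y 1).1 q.2 (Y 0).1 + g q.1 (Y 1).2 (Y 0).1) := by
  have key : ∀ A B : E × E, ∀ b : Fin 1 → E × E, b 0 = B →
      fderiv ℝ (fun q' => lagrangeExpr g q' b) q A =
        fderiv ℝ g q.1 A.1 q.2 B.1 + g q.1 A.2 B.1 := by
    intro A B b hb
    have h2 : HasFDerivAt (fun q' : E × E => g q'.1 q'.2 B.1) _ q :=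
      ((hg.hasFDerivAt.comp q hasFDerivAt_fst).clm_apply hasFDerivAt_snd).clm_apply
        (hasFDerivAt_const _ _)
    have h3 : (fun q' => lagrangeExpr g q' b) = fun q' : E × E => g q'.1 q'.2 B.1 := by
      funext q'
      simp [lagrangeExpr, hb]
    rw [h3, h2.fderiv]
    simp
    ring
  rw [extDeriv_apply (differentiableAt_lagrangeExpr hg)]
  rw [Fin.sum_univ_two]
  simp only [Fin.val_zero, Fin.val_one, pow_zero, pow_one, one_smul, neg_smul]
  rw [key (Y 0) (Y 1) _ (by simp [Fin.removeNth]), key (Y 1) (Y 0) _ (by simp [Fin.removeNth])]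
  ring

/-- The contraction of the second Lagrange form with the complete lift of a Killing field is
minus the differential of the momentum. -/
theorem extDeriv_lagrangeExpr_completeLift {g : E → E →L[ℝ] E →L[ℝ] ℝ} {V : E → E} {x u : E}
    (hg : DifferentiableAt ℝ g x) (hV : DifferentiableAt ℝ V x)
    (hsymm : ∀ᶠ y in 𝓝 x, ∀ a b, g y a b = g y b a)
    (hK : ∀ a b, fderiv ℝ g x (V x) a b + g x (fderiv ℝ V x a) b + g x a (fderiv ℝ V x b) = 0)
    {Y : Fin 2 → E × E} {c d : ℝ}
    (hY : Y 0 = (c • V x, c • fderiv ℝ V x u + d • V x))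
    (hpos : g x (V x) (V x) ≠ 0)
    (h0 : fderiv ℝ (momentumExpr g V) (x, u) (Y 0) = 0)
    (h1 : fderiv ℝ (momentumExpr g V) (x, u) (Y 1) = 0) :
    extDeriv (lagrangeExpr g) (x, u) Y = 0 := by
  -- The symmetry of `g` is also needed for its derivative, which is why it is assumed near `x` and
  -- not only at `x`.
  have hs' : ∀ c a b, fderiv ℝ g x c a b = fderiv ℝ g x c b a := by
    intro c a b
    have h1 : ∀ a b, HasFDerivAt (fun y => g y a b) _ x := fun a b =>
      (hg.hasFDerivAt.clm_apply (hasFDerivAt_const a x)).clm_apply (hasFDerivAt_const b x)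
    have h2 := congrArg (fun L : E →L[ℝ] ℝ => L c) ((h1 a b).unique
      ((h1 b a).congr_of_eventuallyEq (hsymm.mono fun y hy => hy a b)))
    simpa using h2
  have hs := hsymm.self_of_nhds
  rw [extDeriv_lagrangeExpr_apply (q := (x, u)) hg]
  rw [fderiv_momentumExpr_apply (q := (x, u)) hg hV] at h0 h1
  rw [hY] at h0 ⊢
  simp only [map_smul, map_add, smul_apply, add_apply,
    smul_eq_mul] at h0 h1 ⊢
  have k1 := hK (V x) u
  have k2 := hK u (Y 1).1
  -- By the Killing equation `dJ` kills the complete lift, so tangency of `Y 0` reduces to `d * g(V,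
  -- V) = 0`.
  have hd : d = 0 := by
    have : d * g x (V x) (V x) = 0 := by linear_combination h0 - c * k1
    exact (mul_eq_zero.1 this).resolve_right hpos
  subst hd
  -- Up to symmetry of `g`, the value of the two-form is `-c * dJ(Y 1)` plus `c` times the Killing
  -- equation for `u` and the base part of `Y 1`.
  linear_combination c * k2 - c * h1 + c * hs (V x) (Y 1).2 + c * hs (fderiv ℝ V x (Y 1).1) u
    + c * hs' (Y 1).1 (V x) u

end Calculus

/-! ### Pull-back of forms on manifolds, and its compatibility with the exterior derivative. -/

section Pullback

variable {E : Type*} [NormedAddCommGroup E] [NormedSpace ℝ E]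
  {H : Type*} [TopologicalSpace H] {I : ModelWithCorners ℝ E H}
  {N : Type*} [TopologicalSpace N] [ChartedSpace H N]
  {E₁ : Type*} [NormedAddCommGroup E₁] [NormedSpace ℝ E₁]
  {H₁ : Type*} [TopologicalSpace H₁] {I₁ : ModelWithCorners ℝ E₁ H₁}
  {N₁ : Type*} [TopologicalSpace N₁] [ChartedSpace H₁ N₁]
  {E₂ : Type*} [NormedAddCommGroup E₂] [NormedSpace ℝ E₂]
  {H₂ : Type*} [TopologicalSpace H₂] {I₂ : ModelWithCorners ℝ E₂ H₂}
  {N₂ : Type*} [TopologicalSpace N₂] [ChartedSpace H₂ N₂] {j : ℕ}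

variable (I I₁) in
/-- The pull-back of a differential form by a map of manifolds. -/
def pullbackForm (f : N₁ → N) (α : DiffForm I N j) : DiffForm I₁ N₁ j := fun y =>
  (α (f y)).compContinuousLinearMap (mfderiv I₁ I f y)

theorem pullbackForm_congr {f f' : N₁ → N} {y : N₁} (h : f =ᶠ[𝓝 y] f') (α : DiffForm I N j) :
    pullbackForm I I₁ f α y = pullbackForm I I₁ f' α y := by
  -- All tangent spaces unfold to the model space; reading the form as a map into one fixed space
  -- allows rewriting along equal base points.
  have key : ∀ (β : N → E [⋀^Fin j]→L[ℝ] ℝ) (a b : N) (L L' : E₁ →L[ℝ] E), a = b → L = L' →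
      (β a).compContinuousLinearMap L = (β b).compContinuousLinearMap L' := by
    rintro β a _ L _ rfl rfl
    rfl
  exact key α _ _ _ _ h.self_of_nhds h.mfderiv_eq

theorem pullbackForm_comp {f : N₁ → N} {h : N₂ → N₁} {y : N₂}
    (hf : MDifferentiableAt I₁ I f (h y)) (hh : MDifferentiableAt I₂ I₁ h y)
    (α : DiffForm I N j) :
    pullbackForm I I₂ (f ∘ h) α y = pullbackForm I₁ I₂ h (pullbackForm I I₁ f α) y := by
  unfold pullbackForm
  rw [mfderiv_comp y hf hh]
  rfl

variable [I.Boundaryless] [IsManifold I ∞ N]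

/-- The local expression of a form in the preferred chart around `x`. -/
def formExpr (α : DiffForm I N j) (x : N) : E → E [⋀^Fin j]→L[ℝ] ℝ :=
  pullbackForm I 𝓘(ℝ, E) (extChartAt I x).symm α

/-- The model has no boundary, so the range is everything, and the preferred chart has identity
differential at its own centre. -/
theorem extDerivForm_eq (α : DiffForm I N j) (x : N) :
    extDerivForm I α x = extDeriv (formExpr α x) (extChartAt I x x) := by
  have : IsManifold I 1 N := IsManifold.of_le (n := ∞) (by simp)
  unfold extDerivForm
  rw [mfderiv_extChartAt_self]
  simp only [I.range_eq_univ, extDerivWithin_univ, mfderivWithin_univ]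
  rfl

/-- Invariance says that the local expression around `x` is the pull-back, by `f` read in charts, of
the one around `f x`; the exterior derivative in the model space commutes with this pull-back. -/
theorem pullbackForm_extDerivForm {f : N → N} (hf : ContMDiff I I ∞ f) {α : DiffForm I N j}
    (hα : pullbackForm I I f α = α) {x : N}
    (hd : DifferentiableAt ℝ (formExpr α (f x)) (extChartAt I (f x) (f x))) :
    pullbackForm I I f (extDerivForm I α) x = extDerivForm I α x := by
  have : IsManifold I 1 N := IsManifold.of_le (n := ∞) (by simp)
  set y₀ := extChartAt I x x
  set F : E → E := extChartAt I (f x) ∘ f ∘ (extChartAt I x).symm with hF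
  have hx : (extChartAt I x).symm y₀ = x := extChartAt_to_inv x
  have hFy : F y₀ = extChartAt I (f x) (f x) := by rw [hF, comp_apply, comp_apply, hx]
  have hFs : ContDiffAt ℝ ∞ F y₀ := by
    have := (contMDiffAt_iff.1 (hf x)).2
    rwa [I.range_eq_univ, contDiffWithinAt_univ] at this
  have hFd : fderiv ℝ F y₀ = mfderiv I I f x := by
    rw [(hf.mdifferentiableAt (by simp)).mfderiv, I.range_eq_univ, fderivWithin_univ]
    rfl
  have hsymm : ContinuousAt (extChartAt I x).symm y₀ := continuousAt_extChartAt_symm x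
  have hev : formExpr α x =ᶠ[𝓝 y₀]
      fun y => (formExpr α (f x) (F y)).compContinuousLinearMap (fderiv ℝ F y) := by
    have h1 : ∀ᶠ y in 𝓝 y₀, y ∈ (extChartAt I x).target := extChartAt_target_mem_nhds x
    have h2 : ∀ᶠ y in 𝓝 y₀, f ((extChartAt I x).symm y) ∈ (extChartAt I (f x)).source := by
      refine (hf.continuous.continuousAt.comp hsymm).eventually ?_
      rw [comp_apply, hx]
      exact extChartAt_source_mem_nhds (f x)
    filter_upwards [h1.eventually_nhds, h2.eventually_nhds] with y hy1 hy2
    have d1 : MDifferentiableAt 𝓘(ℝ, E) I (extChartAt I x).symm y := by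
      have := mdifferentiableWithinAt_extChartAt_symm hy1.self_of_nhds
      rwa [I.range_eq_univ, mdifferentiableWithinAt_univ] at this
    have d2 : MDifferentiableAt I I f ((extChartAt I x).symm y) :=
      hf.mdifferentiableAt (by simp)
    have d3 : MDifferentiableAt I 𝓘(ℝ, E) (extChartAt I (f x)) (f ((extChartAt I x).symm y)) :=
      mdifferentiableAt_extChartAt (by simpa using hy2.self_of_nhds)
    have d4 : MDifferentiableAt 𝓘(ℝ, E) I (extChartAt I (f x)).symm (F y) := by
      have := mdifferentiableWithinAt_extChartAt_symm
        ((extChartAt I (f x)).map_source hy2.self_of_nhds)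
      rwa [I.range_eq_univ, mdifferentiableWithinAt_univ] at this
    have d5 : MDifferentiableAt 𝓘(ℝ, E) 𝓘(ℝ, E) F y := d3.comp y (d2.comp y d1)
    have e1 : f ∘ (extChartAt I x).symm =ᶠ[𝓝 y] (extChartAt I (f x)).symm ∘ F := by
      filter_upwards [hy2] with z hz
      exact ((extChartAt I (f x)).left_inv hz).symm
    have a1 : formExpr α x y =
        pullbackForm I 𝓘(ℝ, E) (extChartAt I x).symm (pullbackForm I I f α) y := by
      rw [hα]; rfl
    have a2 : pullbackForm 𝓘(ℝ, E) 𝓘(ℝ, E) F (formExpr α (f x)) y =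
        (formExpr α (f x) (F y)).compContinuousLinearMap (fderiv ℝ F y) := by
      rw [← mfderiv_eq_fderiv]
      rfl
    exact a1.trans ((pullbackForm_comp d2 d1 α).symm.trans
      ((pullbackForm_congr e1 α).trans ((pullbackForm_comp d4 d5 α).trans a2)))
  rw [extDerivForm_eq, hev.extDeriv_eq,
    extDeriv_pullback (r := ∞) (by rwa [hFy]) hFs (by simpa using two_le_infty), hFy, hFd,
    ← extDerivForm_eq]
  rfl

end Pullback

/-! ### The charts of the tangent bundle in terms of those of the base. -/

section TangentChart

variable {E : Type*} [NormedAddCommGroup E] [NormedSpace ℝ E]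
  {M : Type*} [TopologicalSpace M] [ChartedSpace E M] [IsManifold 𝓘(ℝ, E) ∞ M]

theorem mem_extChartAt_tangent_target {w : TangentBundle 𝓘(ℝ, E) M} {q : E × E} :
    q ∈ (extChartAt (𝓘(ℝ, E).tangent) w).target ↔
      q.1 ∈ (extChartAt 𝓘(ℝ, E) w.proj).target := by
  have h := TangentBundle.mem_chart_target_iff (I := 𝓘(ℝ, E)) (q : ModelProd E E) w
  rw [extChartAt_target, ModelWithCorners.range_eq_univ, inter_univ]
  exact h.trans (by simp)

theorem extChartAt_tangent_symm_apply {w : TangentBundle 𝓘(ℝ, E) M} {q : E × E}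
    (hq : q.1 ∈ (extChartAt 𝓘(ℝ, E) w.proj).target) :
    (extChartAt (𝓘(ℝ, E).tangent) w).symm q =
      ⟨(extChartAt 𝓘(ℝ, E) w.proj).symm q.1,
        mfderiv 𝓘(ℝ, E) 𝓘(ℝ, E) (extChartAt 𝓘(ℝ, E) w.proj).symm q.1 q.2⟩ := by
  have : IsManifold 𝓘(ℝ, E) 1 M := IsManifold.of_le (n := ∞) (by simp)
  have h := tangentMap_chart_symm (I := 𝓘(ℝ, E)) (p := w)
    (q := (⟨q.1, q.2⟩ : TangentBundle 𝓘(ℝ, E) E)) (by simpa using hq)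
  simp only [tangentMap] at h
  have h' : (extChartAt (𝓘(ℝ, E).tangent) w).symm q = (chartAt (ModelProd E E) w).symm q := rfl
  rw [h']
  refine h.symm.trans ?_
  rfl

theorem extChartAt_tangent_apply_self (w : TangentBundle 𝓘(ℝ, E) M)  :
    (extChartAt (𝓘(ℝ, E).tangent) w) w = (extChartAt 𝓘(ℝ, E) w.proj w.proj, w.snd) := by
  refine Prod.ext rfl ?_
  exact (tangentBundleCore 𝓘(ℝ, E) M).coordChange_self (achart E w.proj) w.proj
    (mem_achart_source E w.proj) w.snd

end TangentChart

/-! ### The metric and the first Lagrange form in charts. -/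

section MetricExpr

variable {E : Type*} [NormedAddCommGroup E] [NormedSpace ℝ E]
  {M : Type*} [TopologicalSpace M] [ChartedSpace E M] [IsManifold 𝓘(ℝ, E) ∞ M]

theorem isManifold_one : IsManifold 𝓘(ℝ, E) 1 M := IsManifold.of_le (n := ∞) (by simp)

variable (E) in
/-- The differential of the inverse of the preferred chart around `x`. -/
def chartFrame (x : M) (z : E) : E →L[ℝ] E :=
  mfderiv 𝓘(ℝ, E) 𝓘(ℝ, E) (extChartAt 𝓘(ℝ, E) x).symm z

theorem chartFrame_self (x : M) :
    chartFrame E x (extChartAt 𝓘(ℝ, E) x x) = ContinuousLinearMap.id ℝ E := by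
  have := isManifold_one (E := E) (M := M)
  have h := mfderivWithin_range_extChartAt_symm (I := 𝓘(ℝ, E)) (x := x)
  rw [ModelWithCorners.range_eq_univ, mfderivWithin_univ] at h
  exact h

theorem mdifferentiableAt_extChartAt_symm {x : M} {z : E}
    (hz : z ∈ (extChartAt 𝓘(ℝ, E) x).target) :
    MDifferentiableAt 𝓘(ℝ, E) 𝓘(ℝ, E) (extChartAt 𝓘(ℝ, E) x).symm z := by
  have := isManifold_one (E := E) (M := M)
  have h := mdifferentiableWithinAt_extChartAt_symm (I := 𝓘(ℝ, E)) hz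
  rwa [ModelWithCorners.range_eq_univ, mdifferentiableWithinAt_univ] at h

/-- The local expression of a Riemannian metric in the preferred chart around `x`. -/
def metricExpr (m : Metric E M) (x : M) (z : E) : E →L[ℝ] E →L[ℝ] ℝ :=
  ContinuousLinearMap.bilinearComp (E := E) (F := E) (m.inner ((extChartAt 𝓘(ℝ, E) x).symm z))
    (chartFrame E x z) (chartFrame E x z)

theorem metricExpr_apply (m : Metric E M) (x : M) (z a b : E) :
    metricExpr m x z a b =
      m.inner ((extChartAt 𝓘(ℝ, E) x).symm z) (chartFrame E x z a) (chartFrame E x z b) := rfl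

theorem metricExpr_symm (m : Metric E M) (x : M) (z a b : E) :
    metricExpr m x z a b = metricExpr m x z b a := by
  rw [metricExpr_apply, metricExpr_apply]
  exact m.symm _ _ _

/-- Moves between a point and the image of its coordinates under the inverse chart: these are equal
without being definitionally so, while both tangent spaces unfold to `E`. -/
theorem inner_congr (m : Metric E M) {x y : M} (h : x = y) (a b : E) :
    m.inner x a b = m.inner y a b := by
  subst h; rfl

theorem metricExpr_self (m : Metric E M) (x : M) (a b : E) :
    metricExpr m x (extChartAt 𝓘(ℝ, E) x x) a b = m.inner x a b := by
  rw [metricExpr_apply, chartFrame_self]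
  exact inner_congr m (extChartAt_to_inv x) a b

/-- In finite dimension it suffices to test on constant vectors `a`, `b`. Each gives a smooth
section along the inverse chart, namely the inverse chart of `TM` at constant fibre coordinate. -/
theorem contDiffOn_metricExpr [FiniteDimensional ℝ E] (m : Metric E M) (x : M) :
    ContDiffOn ℝ ∞ (metricExpr m x) (extChartAt 𝓘(ℝ, E) x).target := by
  rw [contDiffOn_clm_apply]
  intro a
  rw [contDiffOn_clm_apply]
  intro b
  have hs : ∀ a : E, ContMDiffOn 𝓘(ℝ, E) (𝓘(ℝ, E).tangent) ∞
      (fun z => (TotalSpace.mk' E ((extChartAt 𝓘(ℝ, E) x).symm z) (chartFrame E x z a) :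
        TangentBundle 𝓘(ℝ, E) M)) (extChartAt 𝓘(ℝ, E) x).target := by
    intro a
    -- The zero vector is an arbitrary choice: the chart of `TM` at `w` depends only on the base
    -- point.
    set w : TangentBundle 𝓘(ℝ, E) M := ⟨x, 0⟩
    have h1 : ContMDiffOn 𝓘(ℝ, E × E) (𝓘(ℝ, E).tangent) ∞
        (extChartAt (𝓘(ℝ, E).tangent) w).symm (extChartAt (𝓘(ℝ, E).tangent) w).target :=
      contMDiffOn_extChartAt_symm w
    have h2 : ContMDiffOn 𝓘(ℝ, E) 𝓘(ℝ, E × E) ∞ (fun z : E => (z, a))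
        (extChartAt 𝓘(ℝ, E) x).target :=
      (contDiff_id.prodMk contDiff_const).contMDiff.contMDiffOn
    refine (h1.comp h2 fun z hz => mem_extChartAt_tangent_target.2 hz).congr fun z hz => ?_
    exact (extChartAt_tangent_symm_apply (w := w) (q := (z, a)) hz).symm
  have hb : ContMDiffOn 𝓘(ℝ, E) 𝓘(ℝ, E) ∞ (extChartAt 𝓘(ℝ, E) x).symm
      (extChartAt 𝓘(ℝ, E) x).target := contMDiffOn_extChartAt_symm x
  have h : ContMDiffOn 𝓘(ℝ, E) (𝓘(ℝ, E).prod 𝓘(ℝ)) ∞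
      (fun z => TotalSpace.mk' ℝ (E := Bundle.Trivial M ℝ) ((extChartAt 𝓘(ℝ, E) x).symm z)
        (metricExpr m x z a b)) (extChartAt 𝓘(ℝ, E) x).target := by
    apply ContMDiffOn.clm_bundle_apply₂ (F₁ := E) (F₂ := E)
    · exact m.contMDiff.comp_contMDiffOn hb
    · exact hs a
    · exact hs b
  rw [← contMDiffOn_iff_contDiffOn]
  intro z hz
  have := h z hz
  simp only [contMDiffWithinAt_totalSpace] at this
  exact this.2

/-- In the charts, the first Lagrange form is the form `lagrangeExpr`. -/
theorem formExpr_lagrangeOneForm (m : Metric E M) (w : TangentBundle 𝓘(ℝ, E) M) {q : E × E}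
    (hq : q.1 ∈ (extChartAt 𝓘(ℝ, E) w.proj).target) :
    formExpr (lagrangeOneForm m) w q = lagrangeExpr (metricExpr m w.proj) q := by
  have := isManifold_one (E := E) (M := M)
  have hq' : q ∈ (extChartAt (𝓘(ℝ, E).tangent) w).target := mem_extChartAt_tangent_target.2 hq
  have h1 : MDifferentiableAt 𝓘(ℝ, E × E) (𝓘(ℝ, E).tangent)
      (extChartAt (𝓘(ℝ, E).tangent) w).symm q := by
    have h := mdifferentiableWithinAt_extChartAt_symm hq'
    rwa [ModelWithCorners.range_eq_univ, mdifferentiableWithinAt_univ] at h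
  have h2 : MDifferentiableAt (𝓘(ℝ, E).tangent) 𝓘(ℝ, E)
      (fun u : TangentBundle 𝓘(ℝ, E) M => u.proj) ((extChartAt (𝓘(ℝ, E).tangent) w).symm q) :=
    (contMDiff_proj (n := ∞) (TangentSpace 𝓘(ℝ, E) (M := M))).mdifferentiableAt (by simp)
  have h3 : ∀ Y : E × E, mfderiv (𝓘(ℝ, E).tangent) 𝓘(ℝ, E)
      (fun u : TangentBundle 𝓘(ℝ, E) M => u.proj) ((extChartAt (𝓘(ℝ, E).tangent) w).symm q)
      (mfderiv 𝓘(ℝ, E × E) (𝓘(ℝ, E).tangent) (extChartAt (𝓘(ℝ, E).tangent) w).symm q Y) =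
      chartFrame E w.proj q.1 Y.1 := by
    intro Y
    have e1 := mfderiv_comp q h2 h1
    have e2 : (fun u : TangentBundle 𝓘(ℝ, E) M => u.proj) ∘
        (extChartAt (𝓘(ℝ, E).tangent) w).symm =
          (extChartAt 𝓘(ℝ, E) w.proj).symm ∘ (Prod.fst : E × E → E) := rfl
    have h5 : MDifferentiableAt 𝓘(ℝ, E × E) 𝓘(ℝ, E) (Prod.fst : E × E → E) q :=
      differentiableAt_fst.mdifferentiableAt
    have e3 := mfderiv_comp q (mdifferentiableAt_extChartAt_symm hq) h5
    have e4 : mfderiv 𝓘(ℝ, E × E) 𝓘(ℝ, E) (Prod.fst : E × E → E) q =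
        ContinuousLinearMap.fst ℝ E E := by
      rw [mfderiv_eq_fderiv, fderiv_fst]
    have e5 : (mfderiv 𝓘(ℝ, E × E) 𝓘(ℝ, E) ((fun u : TangentBundle 𝓘(ℝ, E) M => u.proj) ∘
        (extChartAt (𝓘(ℝ, E).tangent) w).symm) q : E × E →L[ℝ] E) Y =
        chartFrame E w.proj q.1 Y.1 := by
      rw [e2, e3, e4]; rfl
    rw [e1] at e5
    exact e5
  have h4 : ((extChartAt (𝓘(ℝ, E).tangent) w).symm q).snd = chartFrame E w.proj q.1 q.2 := by
    have h := extChartAt_tangent_symm_apply (w := w) hq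
    -- The type of `snd` depends on the point; making the point a variable allows substitution.
    generalize (extChartAt (𝓘(ℝ, E).tangent) w).symm q = w' at h
    subst h
    rfl
  ext Y
  have : formExpr (lagrangeOneForm m) w q Y =
    m.inner ((extChartAt (𝓘(ℝ, E).tangent) w).symm q).proj
      ((extChartAt (𝓘(ℝ, E).tangent) w).symm q).snd
      (mfderiv (𝓘(ℝ, E).tangent) 𝓘(ℝ, E)
      (fun u : TangentBundle 𝓘(ℝ, E) M => u.proj) ((extChartAt (𝓘(ℝ, E).tangent) w).symm q)
      (mfderiv 𝓘(ℝ, E × E) (𝓘(ℝ, E).tangent) (extChartAt (𝓘(ℝ, E).tangent) w).symm q (Y 0))) :=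
    rfl
  rw [this, h3, h4]
  rfl

end MetricExpr

/-! ### The one-parameter group in charts: generating field, Killing equation, momentum. -/

section Flow

variable {E : Type*} [NormedAddCommGroup E] [NormedSpace ℝ E]
  {M : Type*} [TopologicalSpace M] [ChartedSpace E M] [IsManifold 𝓘(ℝ, E) ∞ M]
  {G : Type*} [TopologicalSpace G] [ChartedSpace ℝ G] [Group G]
  [MulAction G M] [ContMDiffSMul 𝓘(ℝ, ℝ) 𝓘(ℝ, E) ∞ G M]
  {γ : ℝ → G}

theorem IsOneParameterGroup.map_zero (hγ : IsOneParameterGroup γ) : γ 0 = 1 := by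
  have h := hγ.map_add 0 0
  rw [add_zero] at h
  exact left_eq_mul.1 h

theorem IsOneParameterGroup.mul_comm (hγ : IsOneParameterGroup γ) (a b : G) : a * b = b * a := by
  obtain ⟨s, rfl⟩ := hγ.surjective a
  obtain ⟨t, rfl⟩ := hγ.surjective b
  rw [← hγ.map_add, add_comm, hγ.map_add]

variable (E M) in
theorem contMDiff_smul_left (h : G) : ContMDiff 𝓘(ℝ, E) 𝓘(ℝ, E) ∞ (fun x : M => h • x) :=
  ContMDiffSMul.contMDiff_const_smul (I := 𝓘(ℝ, ℝ)) h

theorem IsOneParameterGroup.contMDiff_orbit (hγ : IsOneParameterGroup γ) (x : M) :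
    ContMDiff 𝓘(ℝ, ℝ) 𝓘(ℝ, E) ∞ (fun τ : ℝ => γ τ • x) :=
  hγ.contMDiff.smul (I := 𝓘(ℝ, ℝ)) contMDiff_const

variable (E) in
/-- The local expression of the one-parameter group in the preferred chart around `x`. -/
def flowExpr (γ : ℝ → G) (x : M) (q : ℝ × E) : E :=
  extChartAt 𝓘(ℝ, E) x (γ q.1 • (extChartAt 𝓘(ℝ, E) x).symm q.2)

variable (E) in
/-- The local expression of the generating vector field in the preferred chart around `x`. -/
def generatorExpr (γ : ℝ → G) (x : M) : E → E := initialVelocity (flowExpr E γ x)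

theorem IsOneParameterGroup.contDiffAt_flowExpr (hγ : IsOneParameterGroup γ) {x : M} {τ : ℝ} {z : E}
    (hz : z ∈ (extChartAt 𝓘(ℝ, E) x).target)
    (hτ : γ τ • (extChartAt 𝓘(ℝ, E) x).symm z ∈ (extChartAt 𝓘(ℝ, E) x).source) :
    ContDiffAt ℝ ∞ (flowExpr E γ x) (τ, z) := by
  rw [← contMDiffAt_iff_contDiffAt]
  have h1 : ContMDiffAt 𝓘(ℝ, E) 𝓘(ℝ, E) ∞ (extChartAt 𝓘(ℝ, E) x).symm z :=
    (contMDiffOn_extChartAt_symm x).contMDiffAt ((isOpen_extChartAt_target x).mem_nhds hz)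
  have h2 : ContMDiffAt 𝓘(ℝ, E) 𝓘(ℝ, E) ∞ (extChartAt 𝓘(ℝ, E) x)
      (γ τ • (extChartAt 𝓘(ℝ, E) x).symm z) :=
    contMDiffAt_extChartAt' (by simpa using hτ)
  have h3 : ContMDiffAt 𝓘(ℝ, ℝ × E) 𝓘(ℝ, ℝ) ∞ (fun q : ℝ × E => γ q.1) (τ, z) :=
    hγ.contMDiff.contMDiffAt.comp (τ, z) contDiff_fst.contMDiff.contMDiffAt
  have h4 : ContMDiffAt 𝓘(ℝ, ℝ × E) 𝓘(ℝ, E) ∞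
      (fun q : ℝ × E => (extChartAt 𝓘(ℝ, E) x).symm q.2) (τ, z) :=
    ContMDiffAt.comp (τ, z) h1 contDiff_snd.contMDiff.contMDiffAt
  exact ContMDiffAt.comp (τ, z) h2 (h3.smul (I := 𝓘(ℝ, ℝ)) h4)

theorem IsOneParameterGroup.flowExpr_zero (hγ : IsOneParameterGroup γ) {x : M} {z : E}
    (hz : z ∈ (extChartAt 𝓘(ℝ, E) x).target) : flowExpr E γ x (0, z) = z := by
  simp only [flowExpr, hγ.map_zero, one_smul]
  exact (extChartAt 𝓘(ℝ, E) x).right_inv hz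

theorem IsOneParameterGroup.contDiffAt_flowExpr_zero (hγ : IsOneParameterGroup γ) {x : M} {z : E}
    (hz : z ∈ (extChartAt 𝓘(ℝ, E) x).target) : ContDiffAt ℝ ∞ (flowExpr E γ x) (0, z) := by
  refine hγ.contDiffAt_flowExpr hz ?_
  rw [hγ.map_zero, one_smul]
  exact (extChartAt 𝓘(ℝ, E) x).map_target hz

theorem IsOneParameterGroup.contDiffAt_generatorExpr (hγ : IsOneParameterGroup γ) {x : M} {z : E}
    (hz : z ∈ (extChartAt 𝓘(ℝ, E) x).target) : ContDiffAt ℝ ∞ (generatorExpr E γ x) z := by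
  have h1 : ContDiffAt ℝ ∞ (fderiv ℝ (flowExpr E γ x)) (0, z) :=
    (hγ.contDiffAt_flowExpr_zero hz).fderiv_right (by simp)
  have h2 : ContDiffAt ℝ ∞ (fun z : E => ((0 : ℝ), z)) z := contDiffAt_const.prodMk contDiffAt_id
  exact (h1.comp z h2).clm_apply contDiffAt_const

theorem IsOneParameterGroup.eventually_smul_mem_source (hγ : IsOneParameterGroup γ) {x y : M}
    (hy : y ∈ (extChartAt 𝓘(ℝ, E) x).source) :
    ∀ᶠ τ : ℝ in 𝓝 0, γ τ • y ∈ (extChartAt 𝓘(ℝ, E) x).source := by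
  refine (hγ.contMDiff_orbit (E := E) y).continuous.continuousAt.eventually ?_
  simp only [hγ.map_zero, one_smul]
  exact (isOpen_extChartAt_source x).mem_nhds hy

theorem IsOneParameterGroup.hasDerivAt_flowExpr (hγ : IsOneParameterGroup γ) {x : M} {z : E}
    (hz : z ∈ (extChartAt 𝓘(ℝ, E) x).target) :
    HasDerivAt (fun τ : ℝ => flowExpr E γ x (τ, z)) (generatorExpr E γ x z) 0 := by
  have hline : HasDerivAt (fun τ : ℝ => (τ, z)) ((1 : ℝ), (0 : E)) 0 :=
    (hasDerivAt_id _).prodMk (hasDerivAt_const _ _)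
  exact ((hγ.contDiffAt_flowExpr_zero hz).differentiableAt
    (by simp)).hasFDerivAt.comp_hasDerivAt 0 hline

/-- For small times the orbit stays in the chart domain, where it is the inverse chart applied to
the local flow; the chain rule at time `0` does the rest. -/
theorem IsOneParameterGroup.chartFrame_generatorExpr (hγ : IsOneParameterGroup γ) {x : M} {z : E}
    (hz : z ∈ (extChartAt 𝓘(ℝ, E) x).target) :
    chartFrame E x z (generatorExpr E γ x z) =
      generator (E := E) γ ((extChartAt 𝓘(ℝ, E) x).symm z) := by
  set y := (extChartAt 𝓘(ℝ, E) x).symm z with hy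
  have hys : y ∈ (extChartAt 𝓘(ℝ, E) x).source := (extChartAt 𝓘(ℝ, E) x).map_target hz
  have e1 : (fun τ : ℝ => γ τ • y) =ᶠ[𝓝 0]
      (extChartAt 𝓘(ℝ, E) x).symm ∘ fun τ : ℝ => flowExpr E γ x (τ, z) := by
    filter_upwards [hγ.eventually_smul_mem_source hys] with τ hτ
    exact ((extChartAt 𝓘(ℝ, E) x).left_inv hτ).symm
  have hF := hγ.hasDerivAt_flowExpr hz
  have h0 := hγ.flowExpr_zero hz
  have d1 : MDifferentiableAt 𝓘(ℝ, E) 𝓘(ℝ, E) (extChartAt 𝓘(ℝ, E) x).symm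
      (flowExpr E γ x (0, z)) := by
    rw [h0]; exact mdifferentiableAt_extChartAt_symm hz
  have d2 : MDifferentiableAt 𝓘(ℝ, ℝ) 𝓘(ℝ, E) (fun τ : ℝ => flowExpr E γ x (τ, z)) 0 :=
    hF.differentiableAt.mdifferentiableAt
  have e2 := mfderiv_comp (0 : ℝ) d1 d2
  have e3 : (mfderiv 𝓘(ℝ, ℝ) 𝓘(ℝ, E) (fun τ : ℝ => γ τ • y) 0 : ℝ →L[ℝ] E) =
      mfderiv 𝓘(ℝ, ℝ) 𝓘(ℝ, E)
        ((extChartAt 𝓘(ℝ, E) x).symm ∘ fun τ : ℝ => flowExpr E γ x (τ, z)) 0 := e1.mfderiv_eq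
  have e4 : (mfderiv 𝓘(ℝ, ℝ) 𝓘(ℝ, E) (fun τ : ℝ => γ τ • y) 0 : ℝ →L[ℝ] E) 1 =
      chartFrame E x (flowExpr E γ x (0, z))
        (fderiv ℝ (fun τ : ℝ => flowExpr E γ x (τ, z)) 0 1) := by
    rw [e3, e2, mfderiv_eq_fderiv]
    rfl
  rw [h0, hF.hasFDerivAt.fderiv] at e4
  simp at e4
  exact e4.symm

theorem IsOneParameterGroup.generatorExpr_self (hγ : IsOneParameterGroup γ) (x : M) :
    generatorExpr E γ x (extChartAt 𝓘(ℝ, E) x x) = generator (E := E) γ x := by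
  have h := hγ.chartFrame_generatorExpr (E := E) (mem_extChartAt_target x)
  rw [chartFrame_self] at h
  have key : ∀ y : M, y = x →
      (generator (E := E) γ y : E) = (generator (E := E) γ x : E) := by rintro y rfl; rfl
  exact h.trans (key _ (extChartAt_to_inv x))

/-- The isometry condition conjugated by the chart, hence only for times at which the orbit is still
in its domain. -/
theorem IsOneParameterGroup.metricExpr_flowExpr (hγ : IsOneParameterGroup γ) {m : Metric E M}
    (hm : ActsByIsometries G m) (x : M) (a b : E) :
    ∀ᶠ τ : ℝ in 𝓝 0,
      metricExpr m x (flowExpr E γ x (τ, extChartAt 𝓘(ℝ, E) x x))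
        (fderiv ℝ (flowExpr E γ x) (τ, extChartAt 𝓘(ℝ, E) x x) (0, a))
        (fderiv ℝ (flowExpr E γ x) (τ, extChartAt 𝓘(ℝ, E) x x) (0, b)) =
      metricExpr m x (extChartAt 𝓘(ℝ, E) x x) a b := by
  set z := extChartAt 𝓘(ℝ, E) x x
  have hz : z ∈ (extChartAt 𝓘(ℝ, E) x).target := mem_extChartAt_target x
  set y := (extChartAt 𝓘(ℝ, E) x).symm z
  have hys : y ∈ (extChartAt 𝓘(ℝ, E) x).source := (extChartAt 𝓘(ℝ, E) x).map_target hz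
  filter_upwards [hγ.eventually_smul_mem_source hys] with τ hτ
  have hinv : (extChartAt 𝓘(ℝ, E) x).symm (flowExpr E γ x (τ, z)) = γ τ • y :=
    (extChartAt 𝓘(ℝ, E) x).left_inv hτ
  have hFt : flowExpr E γ x (τ, z) ∈ (extChartAt 𝓘(ℝ, E) x).target :=
    (extChartAt 𝓘(ℝ, E) x).map_source hτ
  have hF : HasFDerivAt (fun z' : E => flowExpr E γ x (τ, z'))
      ((fderiv ℝ (flowExpr E γ x) (τ, z)).comp (ContinuousLinearMap.inr ℝ ℝ E)) z :=
    ((hγ.contDiffAt_flowExpr hz hτ).differentiableAt (by simp)).hasFDerivAt.comp z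
      (hasFDerivAt_prodMk_right _ _)
  have e1 : (fun p : M => γ τ • p) ∘ (extChartAt 𝓘(ℝ, E) x).symm =ᶠ[𝓝 z]
      (extChartAt 𝓘(ℝ, E) x).symm ∘ fun z' : E => flowExpr E γ x (τ, z') := by
    have hc : ContinuousAt (fun z' : E => γ τ • (extChartAt 𝓘(ℝ, E) x).symm z') z :=
      ContinuousAt.comp (contMDiff_smul_left E M (γ τ)).continuous.continuousAt
        (continuousAt_extChartAt_symm x)
    filter_upwards [hc.eventually ((isOpen_extChartAt_source x).mem_nhds hτ)] with z' hz'
    exact ((extChartAt 𝓘(ℝ, E) x).left_inv hz').symm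
  have key : ∀ c : E, chartFrame E x (flowExpr E γ x (τ, z))
      (fderiv ℝ (flowExpr E γ x) (τ, z) (0, c)) =
      mfderiv 𝓘(ℝ, E) 𝓘(ℝ, E) (fun p : M => γ τ • p) y (chartFrame E x z c) := by
    intro c
    have e2 := mfderiv_comp z (mdifferentiableAt_extChartAt_symm hFt)
      hF.differentiableAt.mdifferentiableAt
    have e3 := mfderiv_comp z (f := (extChartAt 𝓘(ℝ, E) x).symm)
      ((contMDiff_smul_left E M (γ τ)).mdifferentiableAt (by simp) (x := y))
      (mdifferentiableAt_extChartAt_symm hz)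
    have e4 : (mfderiv 𝓘(ℝ, E) 𝓘(ℝ, E)
          ((fun p : M => γ τ • p) ∘ (extChartAt 𝓘(ℝ, E) x).symm) z : E →L[ℝ] E) =
        mfderiv 𝓘(ℝ, E) 𝓘(ℝ, E)
          ((extChartAt 𝓘(ℝ, E) x).symm ∘ fun z' : E => flowExpr E γ x (τ, z')) z :=
      e1.mfderiv_eq
    have e5 : (mfderiv 𝓘(ℝ, E) 𝓘(ℝ, E)
          ((extChartAt 𝓘(ℝ, E) x).symm ∘ fun z' : E => flowExpr E γ x (τ, z')) z : E →L[ℝ] E) c =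
        chartFrame E x (flowExpr E γ x (τ, z))
          (fderiv ℝ (flowExpr E γ x) (τ, z) (0, c)) := by
      rw [e2, mfderiv_eq_fderiv, hF.fderiv]
      rfl
    rw [← e5, ← e4]
    exact congrArg (fun L : E →L[ℝ] E => L c) e3
  rw [metricExpr_apply, key, key]
  exact (inner_congr m hinv _ _).trans (hm (γ τ) y _ _)

/-- The Killing equation for the generating vector field. -/
theorem IsOneParameterGroup.killing [FiniteDimensional ℝ E] (hγ : IsOneParameterGroup γ)
    {m : Metric E M} (hm : ActsByIsometries G m) (x : M) (a b : E) :
    fderiv ℝ (metricExpr m x) (extChartAt 𝓘(ℝ, E) x x)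
        (generatorExpr E γ x (extChartAt 𝓘(ℝ, E) x x)) a b
      + metricExpr m x (extChartAt 𝓘(ℝ, E) x x)
        (fderiv ℝ (generatorExpr E γ x) (extChartAt 𝓘(ℝ, E) x x) a) b
      + metricExpr m x (extChartAt 𝓘(ℝ, E) x x) a
        (fderiv ℝ (generatorExpr E γ x) (extChartAt 𝓘(ℝ, E) x x) b) = 0 := by
  have hz := mem_extChartAt_target (I := 𝓘(ℝ, E)) x
  refine killing_of_isometries (hγ.contDiffAt_flowExpr_zero hz) ?_ ?_
    (hγ.metricExpr_flowExpr hm x) a b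
  · filter_upwards [extChartAt_target_mem_nhds (I := 𝓘(ℝ, E)) x] with y hy
    exact hγ.flowExpr_zero hy
  · exact ((contDiffOn_metricExpr m x).contDiffAt
      (extChartAt_target_mem_nhds x)).differentiableAt (by simp)

theorem IsOneParameterGroup.momentum_extChartAt_symm (hγ : IsOneParameterGroup γ)
    (m : Metric E M) (w : TangentBundle 𝓘(ℝ, E) M) {q : E × E}
    (hq : q.1 ∈ (extChartAt 𝓘(ℝ, E) w.proj).target) :
    momentum m γ ((extChartAt (𝓘(ℝ, E).tangent) w).symm q) =
      momentumExpr (metricExpr m w.proj) (generatorExpr E γ w.proj) q := by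
  rw [extChartAt_tangent_symm_apply hq, momentumExpr, metricExpr_apply,
    hγ.chartFrame_generatorExpr hq]
  rfl

theorem IsOneParameterGroup.momentum_comp_eventuallyEq (hγ : IsOneParameterGroup γ)
    (m : Metric E M) (w : TangentBundle 𝓘(ℝ, E) M) :
    momentum m γ ∘ (extChartAt (𝓘(ℝ, E).tangent) w).symm
      =ᶠ[𝓝 (extChartAt (𝓘(ℝ, E).tangent) w w)]
      momentumExpr (metricExpr m w.proj) (generatorExpr E γ w.proj) := by
  filter_upwards [extChartAt_target_mem_nhds (I := 𝓘(ℝ, E).tangent) w] with q hq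
  exact hγ.momentum_extChartAt_symm m w (mem_extChartAt_tangent_target.1 hq)

theorem IsOneParameterGroup.contMDiff_momentum [FiniteDimensional ℝ E]
    (hγ : IsOneParameterGroup γ) (m : Metric E M) :
    ContMDiff (𝓘(ℝ, E).tangent) 𝓘(ℝ, ℝ) ∞ (momentum m γ) := by
  intro w
  have hz := mem_extChartAt_target (I := 𝓘(ℝ, E)) w.proj
  rw [contMDiffAt_iff_source, ModelWithCorners.range_eq_univ, contMDiffWithinAt_univ,
    contMDiffAt_iff_contDiffAt]
  refine ContDiffAt.congr_of_eventuallyEq ?_ (hγ.momentum_comp_eventuallyEq m w)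
  rw [extChartAt_tangent_apply_self]
  have hg : ContDiffAt ℝ ∞ (metricExpr m w.proj) (extChartAt 𝓘(ℝ, E) w.proj w.proj) :=
    (contDiffOn_metricExpr m w.proj).contDiffAt (extChartAt_target_mem_nhds _)
  set q : E × E := (extChartAt 𝓘(ℝ, E) w.proj w.proj, w.snd)
  exact ((hg.comp q contDiffAt_fst).clm_apply
    ((hγ.contDiffAt_generatorExpr hz).comp q contDiffAt_fst)).clm_apply contDiffAt_snd

theorem IsOneParameterGroup.mfderiv_momentum [FiniteDimensional ℝ E]
    (hγ : IsOneParameterGroup γ) (m : Metric E M) (w : TangentBundle 𝓘(ℝ, E) M) :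
    mfderiv (𝓘(ℝ, E).tangent) 𝓘(ℝ, ℝ) (momentum m γ) w =
      fderiv ℝ (momentumExpr (metricExpr m w.proj) (generatorExpr E γ w.proj))
        (extChartAt 𝓘(ℝ, E) w.proj w.proj, w.snd) := by
  rw [((hγ.contMDiff_momentum m).mdifferentiableAt (by simp)).mfderiv,
    ModelWithCorners.range_eq_univ, fderivWithin_univ]
  refine (hγ.momentum_comp_eventuallyEq m w).fderiv_eq.trans ?_
  rw [extChartAt_tangent_apply_self]
  rfl

end Flow

/-! ### Vertical vectors of the principal bundle. -/

section PrincipalBundle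

variable {E : Type*} [NormedAddCommGroup E] [NormedSpace ℝ E]
  {E' : Type*} [NormedAddCommGroup E'] [NormedSpace ℝ E']
  {M : Type*} [TopologicalSpace M] [ChartedSpace E M] [IsManifold 𝓘(ℝ, E) ∞ M]
  {M' : Type*} [TopologicalSpace M'] [ChartedSpace E' M'] [IsManifold 𝓘(ℝ, E') ∞ M']
  {G : Type*} [TopologicalSpace G] [ChartedSpace ℝ G] [Group G]
  [MulAction G M] [ContMDiffSMul 𝓘(ℝ, ℝ) 𝓘(ℝ, E) ∞ G M]
  {γ : ℝ → G} {p : M → M'}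

/-- A differentiable curve with vanishing velocity is constant. -/
theorem eq_of_mfderiv_eq_zero {c : ℝ → M} (hc : MDifferentiable 𝓘(ℝ, ℝ) 𝓘(ℝ, E) c)
    (h0 : ∀ τ, mfderiv 𝓘(ℝ, ℝ) 𝓘(ℝ, E) c τ = 0) (s t : ℝ) : c s = c t := by
  have := isManifold_one (E := E) (M := M)
  have hloc : IsLocallyConstant c := by
    rw [IsLocallyConstant.iff_eventually_eq]
    intro τ
    have hsrc : ∀ᶠ σ in 𝓝 τ, c σ ∈ (extChartAt 𝓘(ℝ, E) (c τ)).source :=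
      hc.continuous.continuousAt.eventually (extChartAt_source_mem_nhds (c τ))
    obtain ⟨ε, hε, hball⟩ := Metric.eventually_nhds_iff_ball.1 hsrc
    have hd : ∀ σ ∈ Metric.ball τ ε,
        HasFDerivAt (extChartAt 𝓘(ℝ, E) (c τ) ∘ c) (0 : ℝ →L[ℝ] E) σ := by
      intro σ hσ
      have h1 : MDifferentiableAt 𝓘(ℝ, E) 𝓘(ℝ, E) (extChartAt 𝓘(ℝ, E) (c τ)) (c σ) :=
        mdifferentiableAt_extChartAt (by simpa using hball σ hσ)
      have h2 := (h1.hasMFDerivAt.comp σ (hc σ).hasMFDerivAt)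
      rw [h0 σ, ContinuousLinearMap.comp_zero] at h2
      exact hasMFDerivAt_iff_hasFDerivAt.1 h2
    filter_upwards [Metric.ball_mem_nhds τ hε] with σ hσ
    refine (extChartAt 𝓘(ℝ, E) (c τ)).injOn (hball σ hσ) (hball τ (Metric.mem_ball_self hε)) ?_
    exact Metric.isOpen_ball.is_const_of_fderiv_eq_zero (𝕜 := ℝ)
      (convex_ball τ ε).isPreconnected
      (fun x hx => (hd x hx).differentiableAt.differentiableWithinAt)
      (fun x hx => (hd x hx).fderiv) hσ (Metric.mem_ball_self hε)
  exact hloc.apply_eq_of_preconnectedSpace s t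

/-- A nonempty space charted on `ℝ` has more than one point. -/
theorem not_subsingleton_of_chartedSpace_real (N : Type*) [TopologicalSpace N] [ChartedSpace ℝ N]
    [Nonempty N] : ¬ Subsingleton N := by
  intro hN
  obtain ⟨x⟩ := ‹Nonempty N›
  have h : (chartAt ℝ x).target = {chartAt ℝ x x} := by
    refine Subset.antisymm (fun z hz => ?_) (singleton_subset_iff.2 (mem_chart_target ℝ x))
    rw [mem_singleton_iff, ← (chartAt ℝ x).right_inv hz, Subsingleton.elim ((chartAt ℝ x).symm z) x]
  exact not_isOpen_singleton _ (h ▸ (chartAt ℝ x).open_target)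

theorem IsPrincipalBundle.contMDiff (hp : IsPrincipalBundle E E' G p) :
    ContMDiff 𝓘(ℝ, E) 𝓘(ℝ, E') ∞ p := by
  intro x
  obtain ⟨U, e, hU, hx, hs, ht, he, -, hfst, -⟩ := hp (p x)
  have hxs : x ∈ e.source := by rw [hs]; exact hx
  have h1 : ContMDiffAt 𝓘(ℝ, E) (𝓘(ℝ, E').prod 𝓘(ℝ, ℝ)) ∞ e x :=
    he.contMDiffAt (e.open_source.mem_nhds hxs)
  refine (contMDiffAt_fst.comp x h1).congr_of_eventuallyEq ?_
  filter_upwards [e.open_source.mem_nhds hxs] with y hy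
  exact (hfst y hy).symm

theorem IsPrincipalBundle.apply_smul (hp : IsPrincipalBundle E E' G p) (h : G) (x : M) :
    p (h • x) = p x := by
  obtain ⟨U, e, -, hx, hs, -, -, -, hfst, hact⟩ := hp (p x)
  have hxs : x ∈ e.source := by rw [hs]; exact hx
  obtain ⟨h1, h2⟩ := hact h x hxs
  rw [← hfst _ h1, h2, hfst x hxs]

theorem IsPrincipalBundle.eq_one_of_smul_eq (hp : IsPrincipalBundle E E' G p) {h : G} {x : M}
    (hx : h • x = x) : h = 1 := by
  obtain ⟨U, e, -, hxU, hs, -, -, -, hfst, hact⟩ := hp (p x)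
  have hxs : x ∈ e.source := by rw [hs]; exact hxU
  have h2 := congrArg Prod.snd (hact h x hxs).2
  rw [hx] at h2
  exact right_eq_mul.1 h2

theorem mfderiv_smul_congr (h : G) {x y : M} (hxy : x = y) (a : E) :
    (mfderiv 𝓘(ℝ, E) 𝓘(ℝ, E) (fun z : M => h • z) x a : E) =
      mfderiv 𝓘(ℝ, E) 𝓘(ℝ, E) (fun z : M => h • z) y a := by
  subst hxy; rfl

/-- The derivative of an orbit at any time is the image of the generating vector field. -/
theorem IsOneParameterGroup.mfderiv_smul_orbit (hγ : IsOneParameterGroup γ) (h : G) (x : M) :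
    (mfderiv 𝓘(ℝ, ℝ) 𝓘(ℝ, E) (fun τ : ℝ => h • γ τ • x) 0 : ℝ →L[ℝ] E) 1 =
      mfderiv 𝓘(ℝ, E) 𝓘(ℝ, E) (fun z : M => h • z) x (generator (E := E) γ x) := by
  have e1 := mfderiv_comp (0 : ℝ) (f := fun τ : ℝ => γ τ • x) (g := fun z : M => h • z)
    ((contMDiff_smul_left E M h).mdifferentiableAt (by simp))
    ((hγ.contMDiff_orbit (E := E) x).mdifferentiableAt (by simp))
  have e2 := congrArg (fun L : ℝ →L[ℝ] E => L 1) e1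
  refine e2.trans ?_
  exact mfderiv_smul_congr (E := E) h (x := γ 0 • x) (y := x) (by rw [hγ.map_zero, one_smul])
    (generator (E := E) γ x)

/-- The group is commutative, so `h` carries the orbit curve of `x` to that of `h • x`. -/
theorem IsOneParameterGroup.generator_smul (hγ : IsOneParameterGroup γ) (h : G) (x : M) :
    generator (E := E) γ (h • x) =
      mfderiv 𝓘(ℝ, E) 𝓘(ℝ, E) (fun z : M => h • z) x (generator (E := E) γ x) := by
  have h1 : (fun τ : ℝ => γ τ • h • x) = fun τ : ℝ => h • γ τ • x := by
    funext τ
    rw [smul_smul, smul_smul, hγ.mul_comm]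
  have h2 := hγ.mfderiv_smul_orbit (E := E) h x
  rw [← h1] at h2
  exact h2

/-- If the field vanished at `x`, the orbit curve would have zero velocity at all times and be
constant. Freeness would then make `G` trivial, which a group modelled on `ℝ` is not. -/
theorem IsOneParameterGroup.generator_ne_zero (hγ : IsOneParameterGroup γ)
    (hp : IsPrincipalBundle E E' G p) (x : M) : generator (E := E) γ x ≠ 0 := by
  intro h0
  have hcd := (hγ.contMDiff_orbit (E := E) x).mdifferentiable (by simp)
  have hzero : ∀ τ, mfderiv 𝓘(ℝ, ℝ) 𝓘(ℝ, E) (fun τ : ℝ => γ τ • x) τ = 0 := by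
    intro τ
    -- Writing `σ = τ + (σ - τ)` moves the derivative at `τ` to a derivative at `0`, followed by the
    -- tangent map of `γ τ`.
    have h1 : (fun τ : ℝ => γ τ • x) = (fun σ : ℝ => γ τ • γ σ • x) ∘ fun σ : ℝ => σ - τ := by
      funext σ
      simp only [comp_apply]
      rw [smul_smul, ← hγ.map_add, add_sub_cancel]
    have hd : HasFDerivAt (fun σ : ℝ => σ - τ) (ContinuousLinearMap.id ℝ ℝ) τ :=
      (hasFDerivAt_id τ).sub_const τ
    have d1 : MDifferentiableAt 𝓘(ℝ, ℝ) 𝓘(ℝ, E) (fun σ : ℝ => γ τ • γ σ • x) (τ - τ) :=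
      ((contMDiff_smul_left E M (γ τ)).comp (hγ.contMDiff_orbit x)).mdifferentiableAt (by simp)
    have h2 := mfderiv_comp τ (f := fun σ : ℝ => σ - τ) d1 hd.differentiableAt.mdifferentiableAt
    rw [← h1] at h2
    let L : E →L[ℝ] E := mfderiv 𝓘(ℝ, E) 𝓘(ℝ, E) (fun z : M => γ τ • z) x
    have h3 := (hγ.mfderiv_smul_orbit (E := E) (γ τ) x).trans
      ((congrArg L h0).trans (_root_.map_zero L))
    have h4 : (mfderiv 𝓘(ℝ, ℝ) 𝓘(ℝ, E) (fun τ : ℝ => γ τ • x) τ : ℝ →L[ℝ] E) 1 =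
        (mfderiv 𝓘(ℝ, ℝ) 𝓘(ℝ, E) (fun σ : ℝ => γ τ • γ σ • x) (τ - τ) : ℝ →L[ℝ] E) 1 := by
      refine (congrArg (fun L : ℝ →L[ℝ] E => L 1) h2).trans ?_
      rw [mfderiv_eq_fderiv, hd.fderiv]
      rfl
    rw [sub_self] at h4
    exact ContinuousLinearMap.ext_ring (h4.trans h3)
  have hone : ∀ τ, γ τ = 1 := by
    intro τ
    have h1 := eq_of_mfderiv_eq_zero hcd hzero τ 0
    simp only [hγ.map_zero, one_smul] at h1
    exact hp.eq_one_of_smul_eq h1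
  refine not_subsingleton_of_chartedSpace_real G ⟨fun a b => ?_⟩
  obtain ⟨s, rfl⟩ := hγ.surjective a
  obtain ⟨t, rfl⟩ := hγ.surjective b
  rw [hone, hone]

theorem IsOneParameterGroup.mfderiv_generator_eq_zero (hγ : IsOneParameterGroup γ)
    (hp : IsPrincipalBundle E E' G p) (x : M) :
    (mfderiv 𝓘(ℝ, E) 𝓘(ℝ, E') p x : E →L[ℝ] E') (generator (E := E) γ x) = 0 := by
  have e1 := mfderiv_comp (0 : ℝ) (f := fun τ : ℝ => γ τ • x) (g := p)
    (hp.contMDiff.mdifferentiableAt (by simp))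
    ((hγ.contMDiff_orbit (E := E) x).mdifferentiableAt (by simp))
  have e0 : p ∘ (fun τ : ℝ => γ τ • x) = fun _ => p x := by
    funext τ
    exact hp.apply_smul _ _
  have e3 : (mfderiv 𝓘(ℝ, ℝ) 𝓘(ℝ, E') (p ∘ (fun τ : ℝ => γ τ • x)) 0 : ℝ →L[ℝ] E') = 0 := by
    rw [e0]
    exact mfderiv_const
  have key : ∀ y : M, y = x → ∀ a : E, (mfderiv 𝓘(ℝ, E) 𝓘(ℝ, E') p y : E →L[ℝ] E') a =
      (mfderiv 𝓘(ℝ, E) 𝓘(ℝ, E') p x : E →L[ℝ] E') a := by rintro y rfl a; rfl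
  have e4 := congrArg (fun L : ℝ →L[ℝ] E' => L 1) (e1.symm.trans e3)
  exact (key (γ 0 • x) (by rw [hγ.map_zero, one_smul]) _).symm.trans e4

/-- The vertical vectors of the bundle are the multiples of the generating vector. -/
theorem IsOneParameterGroup.exists_eq_smul_generator (hγ : IsOneParameterGroup γ)
    (hp : IsPrincipalBundle E E' G p) (x : M) {a : E}
    (ha : (mfderiv 𝓘(ℝ, E) 𝓘(ℝ, E') p x : E →L[ℝ] E') a = 0) :
    ∃ c : ℝ, a = c • (generator (E := E) γ x : E) := by
  obtain ⟨U, e, hU, hx, hs, ht, he, he', hfst, -⟩ := hp (p x)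
  have hxs : x ∈ e.source := by rw [hs]; exact hx
  have hem : e.MDifferentiable 𝓘(ℝ, E) (𝓘(ℝ, E').prod 𝓘(ℝ, ℝ)) :=
    ⟨he.mdifferentiableOn (by simp), he'.mdifferentiableOn (by simp)⟩
  let L : E →L[ℝ] E' × ℝ := mfderiv 𝓘(ℝ, E) (𝓘(ℝ, E').prod 𝓘(ℝ, ℝ)) e x
  -- `L` is injective with first component `Tp`, so it embeds the kernel of `Tp` into the line `{0}
  -- × ℝ`, where the image of the generator is nonzero.
  have hinj : Injective L := hem.mfderiv_injective hxs
  have hL : ∀ b : E, (L b).1 = (mfderiv 𝓘(ℝ, E) 𝓘(ℝ, E') p x : E →L[ℝ] E') b := by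
    intro b
    have h1 : p =ᶠ[𝓝 x] Prod.fst ∘ e := by
      filter_upwards [e.open_source.mem_nhds hxs] with y hy
      exact (hfst y hy).symm
    have h2 : (mfderiv 𝓘(ℝ, E) 𝓘(ℝ, E') p x : E →L[ℝ] E') =
        mfderiv 𝓘(ℝ, E) 𝓘(ℝ, E') (Prod.fst ∘ e) x := h1.mfderiv_eq
    have h3 := mfderiv_comp x (mdifferentiableAt_fst (I := 𝓘(ℝ, E')) (I' := 𝓘(ℝ, ℝ)) (x := e x))
      (hem.mdifferentiableAt hxs)
    rw [mfderiv_fst] at h3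
    rw [h2]
    exact (congrArg (fun L : E →L[ℝ] E' => L b) h3).symm
  obtain ⟨v, hv⟩ : ∃ v : E, v = generator (E := E) γ x := ⟨_, rfl⟩
  have hv0 : L v ≠ 0 := fun h =>
    hγ.generator_ne_zero hp x (hv.symm.trans (hinj (h.trans (_root_.map_zero L).symm)))
  have hv1 : (L v).1 = 0 := by
    rw [hL, hv]; exact hγ.mfderiv_generator_eq_zero hp x
  have hv2 : (L v).2 ≠ 0 := fun h => hv0 (Prod.ext hv1 h)
  refine ⟨(L a).2 / (L v).2, ?_⟩
  refine Eq.trans (hinj ?_) (congrArg (fun b : E => ((L a).2 / (L v).2) • b) hv)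
  rw [map_smul]
  refine Prod.ext ?_ ?_
  · rw [hL, ha, Prod.smul_fst, hv1, smul_zero]
    rfl
  · rw [Prod.smul_snd, smul_eq_mul, div_mul_cancel₀ _ hv2]

end PrincipalBundle

/-! ### The tangent map of a smooth map in charts. -/

section TangentMapExpr

variable {E : Type*} [NormedAddCommGroup E] [NormedSpace ℝ E]
  {E' : Type*} [NormedAddCommGroup E'] [NormedSpace ℝ E']
  {M : Type*} [TopologicalSpace M] [ChartedSpace E M] [IsManifold 𝓘(ℝ, E) ∞ M]
  {M' : Type*} [TopologicalSpace M'] [ChartedSpace E' M'] [IsManifold 𝓘(ℝ, E') ∞ M']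
  {p : M → M'}

theorem extChartAt_tangent_apply {w w' : TangentBundle 𝓘(ℝ, E) M}
    (h : w'.proj ∈ (extChartAt 𝓘(ℝ, E) w.proj).source) :
    extChartAt (𝓘(ℝ, E).tangent) w w' = (extChartAt 𝓘(ℝ, E) w.proj w'.proj,
      (mfderiv 𝓘(ℝ, E) 𝓘(ℝ, E) (extChartAt 𝓘(ℝ, E) w.proj) w'.proj : E →L[ℝ] E) w'.snd) := by
  have := isManifold_one (E := E) (M := M)
  have h1 := tangentMap_chart (I := 𝓘(ℝ, E)) (p := w) (q := w') (by simpa using h)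
  have h2 : extChartAt (𝓘(ℝ, E).tangent) w w' = chartAt (ModelProd E E) w w' := rfl
  rw [h2]
  exact (congrArg (TotalSpace.toProd E E) h1).symm

variable (E E') in
/-- The local expression of the map `p` in the preferred charts around `x` and `p x`. -/
def mapExpr (p : M → M') (x : M) : E → E' :=
  extChartAt 𝓘(ℝ, E') (p x) ∘ p ∘ (extChartAt 𝓘(ℝ, E) x).symm

theorem eventually_mem_source (hp : ContMDiff 𝓘(ℝ, E) 𝓘(ℝ, E') ∞ p) (x : M) :
    ∀ᶠ z in 𝓝 (extChartAt 𝓘(ℝ, E) x x),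
      z ∈ (extChartAt 𝓘(ℝ, E) x).target ∧
      p ((extChartAt 𝓘(ℝ, E) x).symm z) ∈ (extChartAt 𝓘(ℝ, E') (p x)).source := by
  have h1 : ∀ᶠ z in 𝓝 (extChartAt 𝓘(ℝ, E) x x), z ∈ (extChartAt 𝓘(ℝ, E) x).target :=
    extChartAt_target_mem_nhds x
  refine h1.and ?_
  refine (hp.continuous.continuousAt.comp (continuousAt_extChartAt_symm x)).eventually ?_
  rw [comp_apply, extChartAt_to_inv]
  exact extChartAt_source_mem_nhds (p x)

theorem contDiffAt_mapExpr (hp : ContMDiff 𝓘(ℝ, E) 𝓘(ℝ, E') ∞ p) (x : M) :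
    ContDiffAt ℝ ∞ (mapExpr E E' p x) (extChartAt 𝓘(ℝ, E) x x) := by
  have := (contMDiffAt_iff.1 (hp x)).2
  rwa [ModelWithCorners.range_eq_univ, contDiffWithinAt_univ] at this

theorem fderiv_mapExpr (hp : ContMDiff 𝓘(ℝ, E) 𝓘(ℝ, E') ∞ p) {x : M} {z : E}
    (hz : z ∈ (extChartAt 𝓘(ℝ, E) x).target)
    (hpz : p ((extChartAt 𝓘(ℝ, E) x).symm z) ∈ (extChartAt 𝓘(ℝ, E') (p x)).source) (a : E) :
    fderiv ℝ (mapExpr E E' p x) z a =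
      (mfderiv 𝓘(ℝ, E') 𝓘(ℝ, E') (extChartAt 𝓘(ℝ, E') (p x))
        (p ((extChartAt 𝓘(ℝ, E) x).symm z)) : E' →L[ℝ] E')
        ((mfderiv 𝓘(ℝ, E) 𝓘(ℝ, E') p ((extChartAt 𝓘(ℝ, E) x).symm z) : E →L[ℝ] E')
          (chartFrame E x z a)) := by
  have := isManifold_one (E := E') (M := M')
  have d1 := mdifferentiableAt_extChartAt_symm hz
  have d2 : MDifferentiableAt 𝓘(ℝ, E) 𝓘(ℝ, E') p ((extChartAt 𝓘(ℝ, E) x).symm z) :=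
    hp.mdifferentiableAt (by simp)
  have d3 : MDifferentiableAt 𝓘(ℝ, E') 𝓘(ℝ, E') (extChartAt 𝓘(ℝ, E') (p x))
      (p ((extChartAt 𝓘(ℝ, E) x).symm z)) := mdifferentiableAt_extChartAt (by simpa using hpz)
  have e := (d3.hasMFDerivAt.comp z (d2.hasMFDerivAt.comp z d1.hasMFDerivAt))
  let A : E' →L[ℝ] E' := mfderiv 𝓘(ℝ, E') 𝓘(ℝ, E') (extChartAt 𝓘(ℝ, E') (p x))
    (p ((extChartAt 𝓘(ℝ, E) x).symm z))
  let B : E →L[ℝ] E' := mfderiv 𝓘(ℝ, E) 𝓘(ℝ, E') p ((extChartAt 𝓘(ℝ, E) x).symm z)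
  have e' : HasFDerivAt (mapExpr E E' p x) (A.comp (B.comp (chartFrame E x z))) z :=
    hasMFDerivAt_iff_hasFDerivAt.1 e
  exact congrArg (fun L : E →L[ℝ] E' => L a) e'.fderiv

theorem fderiv_mapExpr_self (hp : ContMDiff 𝓘(ℝ, E) 𝓘(ℝ, E') ∞ p) (x : M) :
    fderiv ℝ (mapExpr E E' p x) (extChartAt 𝓘(ℝ, E) x x) = mfderiv 𝓘(ℝ, E) 𝓘(ℝ, E') p x := by
  rw [(hp.mdifferentiableAt (by simp)).mfderiv, ModelWithCorners.range_eq_univ, fderivWithin_univ]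
  rfl

/-- In the charts of the tangent bundles, the tangent map is `tangentExpr`. -/
theorem mfderiv_tangentMap (hp : ContMDiff 𝓘(ℝ, E) 𝓘(ℝ, E') ∞ p) (w : TangentBundle 𝓘(ℝ, E) M) :
    mfderiv (𝓘(ℝ, E).tangent) (𝓘(ℝ, E').tangent) (tangentMap 𝓘(ℝ, E) 𝓘(ℝ, E') p) w =
      fderiv ℝ (tangentExpr (mapExpr E E' p w.proj))
        (extChartAt 𝓘(ℝ, E) w.proj w.proj, w.snd) := by
  have := isManifold_one (E := E') (M := M')
  have := isManifold_one (E := E) (M := M)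
  have hT : ContMDiff (𝓘(ℝ, E).tangent) (𝓘(ℝ, E').tangent) ∞
      (tangentMap 𝓘(ℝ, E) 𝓘(ℝ, E') p) := hp.contMDiff_tangentMap (by simp)
  rw [(hT.mdifferentiableAt (by simp)).mfderiv, ModelWithCorners.range_eq_univ, fderivWithin_univ]
  have hev : writtenInExtChartAt (𝓘(ℝ, E).tangent) (𝓘(ℝ, E').tangent) w
      (tangentMap 𝓘(ℝ, E) 𝓘(ℝ, E') p) =ᶠ[𝓝 (extChartAt (𝓘(ℝ, E).tangent) w w)]
      tangentExpr (mapExpr E E' p w.proj) := by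
    have h1 : ∀ᶠ q : E × E in 𝓝 (extChartAt (𝓘(ℝ, E).tangent) w w),
        q.1 ∈ (extChartAt 𝓘(ℝ, E) w.proj).target ∧
        p ((extChartAt 𝓘(ℝ, E) w.proj).symm q.1) ∈
          (extChartAt 𝓘(ℝ, E') (p w.proj)).source := by
      rw [extChartAt_tangent_apply_self]
      exact (continuous_fst.tendsto ((extChartAt 𝓘(ℝ, E) w.proj w.proj, w.snd) : E × E)).eventually
        (eventually_mem_source hp w.proj)
    filter_upwards [h1] with q hq
    rw [writtenInExtChartAt, comp_apply, comp_apply, extChartAt_tangent_symm_apply hq.1]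
    rw [extChartAt_tangent_apply (by exact hq.2)]
    exact Prod.ext rfl (fderiv_mapExpr hp hq.1 hq.2 q.2).symm
  refine hev.fderiv_eq.trans ?_
  rw [extChartAt_tangent_apply_self]
  rfl

end TangentMapExpr

/-! ### Invariance of the momentum and of the Lagrange forms. -/

section Invariance

variable {E : Type*} [NormedAddCommGroup E] [NormedSpace ℝ E]
  {M : Type*} [TopologicalSpace M] [ChartedSpace E M] [IsManifold 𝓘(ℝ, E) ∞ M]
  {G : Type*} [TopologicalSpace G] [ChartedSpace ℝ G] [Group G]
  [MulAction G M] [ContMDiffSMul 𝓘(ℝ, ℝ) 𝓘(ℝ, E) ∞ G M]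
  {γ : ℝ → G} {m : Metric E M}

theorem contMDiff_tangentAction (h : G) :
    ContMDiff (𝓘(ℝ, E).tangent) (𝓘(ℝ, E).tangent) ∞ (tangentAction E M h) := by
  have := isManifold_one (E := E) (M := M)
  exact (contMDiff_smul_left E M h).contMDiff_tangentMap (by simp)

theorem IsOneParameterGroup.momentum_tangentAction (hγ : IsOneParameterGroup γ)
    (hm : ActsByIsometries G m) (h : G) (w : TangentBundle 𝓘(ℝ, E) M) :
    momentum m γ (tangentAction E M h w) = momentum m γ w := by
  have h1 : momentum m γ (tangentAction E M h w) =
    m.inner (h • w.proj) (generator γ (h • w.proj))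
      (mfderiv 𝓘(ℝ, E) 𝓘(ℝ, E) (fun z : M => h • z) w.proj w.snd) := rfl
  rw [h1, hγ.generator_smul]
  exact hm h _ _ _

theorem mfderiv_proj_apply (w : TangentBundle 𝓘(ℝ, E) M) (Y : E × E) :
    (mfderiv (𝓘(ℝ, E).tangent) 𝓘(ℝ, E) (fun u : TangentBundle 𝓘(ℝ, E) M => u.proj) w :
      E × E →L[ℝ] E) Y = Y.1 := by
  have := isManifold_one (E := E) (M := M)
  have hd : MDifferentiableAt (𝓘(ℝ, E).tangent) 𝓘(ℝ, E)
      (fun u : TangentBundle 𝓘(ℝ, E) M => u.proj) w :=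
    (contMDiff_proj (n := ∞) (TangentSpace 𝓘(ℝ, E) (M := M))).mdifferentiableAt (by simp)
  rw [hd.mfderiv, ModelWithCorners.range_eq_univ, fderivWithin_univ]
  have hev : writtenInExtChartAt (𝓘(ℝ, E).tangent) 𝓘(ℝ, E) w
      (fun u : TangentBundle 𝓘(ℝ, E) M => u.proj)
      =ᶠ[𝓝 (extChartAt (𝓘(ℝ, E).tangent) w w)] (Prod.fst : E × E → E) := by
    filter_upwards [extChartAt_target_mem_nhds (I := 𝓘(ℝ, E).tangent) w] with q hq
    exact (extChartAt 𝓘(ℝ, E) w.proj).right_inv (mem_extChartAt_tangent_target.1 hq)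
  refine (congrArg (fun L : E × E →L[ℝ] E => L Y) hev.fderiv_eq).trans ?_
  rw [fderiv_fst]
  rfl

/-- The projection intertwines the actions on `TM` and `M`, so both slots of the inner product are
moved by the same isometry. -/
theorem pullbackForm_lagrangeOneForm (hm : ActsByIsometries G m) (h : G) :
    pullbackForm (𝓘(ℝ, E).tangent) (𝓘(ℝ, E).tangent) (tangentAction E M h) (lagrangeOneForm m) =
      lagrangeOneForm m := by
  have := isManifold_one (E := E) (M := M)
  funext w
  have d1 : MDifferentiableAt (𝓘(ℝ, E).tangent) (𝓘(ℝ, E).tangent) (tangentAction E M h) w :=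
    (contMDiff_tangentAction h).mdifferentiableAt (by simp)
  have d2 : ∀ w, MDifferentiableAt (𝓘(ℝ, E).tangent) 𝓘(ℝ, E)
      (fun u : TangentBundle 𝓘(ℝ, E) M => u.proj) w := fun w =>
    (contMDiff_proj (n := ∞) (TangentSpace 𝓘(ℝ, E) (M := M))).mdifferentiableAt (by simp)
  have e1 := mfderiv_comp w (d2 (tangentAction E M h w)) d1
  have e2 := mfderiv_comp w (f := fun u : TangentBundle 𝓘(ℝ, E) M => u.proj)
    (g := fun x : M => h • x) ((contMDiff_smul_left E M h).mdifferentiableAt (by simp)) (d2 w)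
  have e3 := e1.symm.trans e2
  ext Y
  have e4 : m.inner (h • w.proj) (mfderiv 𝓘(ℝ, E) 𝓘(ℝ, E) (fun z : M => h • z) w.proj w.snd)
      (mfderiv (𝓘(ℝ, E).tangent) 𝓘(ℝ, E) (fun u : TangentBundle 𝓘(ℝ, E) M => u.proj)
        (tangentAction E M h w) (mfderiv (𝓘(ℝ, E).tangent) (𝓘(ℝ, E).tangent)
          (tangentAction E M h) w (Y 0))) =
      m.inner (h • w.proj) (mfderiv 𝓘(ℝ, E) 𝓘(ℝ, E) (fun z : M => h • z) w.proj w.snd)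
        (mfderiv 𝓘(ℝ, E) 𝓘(ℝ, E) (fun z : M => h • z) w.proj
          (mfderiv (𝓘(ℝ, E).tangent) 𝓘(ℝ, E) (fun u : TangentBundle 𝓘(ℝ, E) M => u.proj) w
            (Y 0))) :=
    congrArg (fun L : E × E →L[ℝ] E => m.inner (h • w.proj)
      (mfderiv 𝓘(ℝ, E) 𝓘(ℝ, E) (fun z : M => h • z) w.proj w.snd) (L (Y 0))) e3
  exact e4.trans (hm h w.proj _ _)

theorem formExpr_lagrangeOneForm_eventuallyEq (m : Metric E M) (w : TangentBundle 𝓘(ℝ, E) M) :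
    formExpr (lagrangeOneForm m) w =ᶠ[𝓝 (extChartAt (𝓘(ℝ, E).tangent) w w)]
      lagrangeExpr (metricExpr m w.proj) := by
  filter_upwards [extChartAt_target_mem_nhds (I := 𝓘(ℝ, E).tangent) w] with q hq
  exact formExpr_lagrangeOneForm m w (mem_extChartAt_tangent_target.1 hq)

theorem differentiableAt_metricExpr [FiniteDimensional ℝ E] (m : Metric E M) (x : M) :
    DifferentiableAt ℝ (metricExpr m x) (extChartAt 𝓘(ℝ, E) x x) :=
  ((contDiffOn_metricExpr m x).contDiffAt (extChartAt_target_mem_nhds x)).differentiableAt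
    (by simp)

theorem lagrangeOneForm_apply (m : Metric E M) (w : TangentBundle 𝓘(ℝ, E) M)
    (Y : Fin 1 → E × E) :
    lagrangeOneForm m w Y =
      metricExpr m w.proj (extChartAt 𝓘(ℝ, E) w.proj w.proj) w.snd (Y 0).1 := by
  have h : metricExpr m w.proj (extChartAt 𝓘(ℝ, E) w.proj w.proj) w.snd (Y 0).1 =
      m.inner w.proj w.snd (Y 0).1 := metricExpr_self m w.proj _ _
  refine Eq.trans ?_ h.symm
  exact congrArg (fun a : E => m.inner w.proj w.snd a) (mfderiv_proj_apply w (Y 0))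

theorem lagrangeTwoForm_eq (m : Metric E M) (w : TangentBundle 𝓘(ℝ, E) M) :
    lagrangeTwoForm m w = extDeriv (lagrangeExpr (metricExpr m w.proj))
      (extChartAt 𝓘(ℝ, E) w.proj w.proj, w.snd) := by
  rw [lagrangeTwoForm, extDerivForm_eq]
  refine (formExpr_lagrangeOneForm_eventuallyEq m w).extDeriv_eq.trans ?_
  rw [extChartAt_tangent_apply_self]
  rfl

theorem pullbackForm_lagrangeTwoForm [FiniteDimensional ℝ E] (hm : ActsByIsometries G m) (h : G) :
    pullbackForm (𝓘(ℝ, E).tangent) (𝓘(ℝ, E).tangent) (tangentAction E M h) (lagrangeTwoForm m) =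
      lagrangeTwoForm m := by
  funext w
  refine pullbackForm_extDerivForm (contMDiff_tangentAction h)
    (pullbackForm_lagrangeOneForm hm h) ?_
  refine DifferentiableAt.congr_of_eventuallyEq ?_
    (formExpr_lagrangeOneForm_eventuallyEq m (tangentAction E M h w))
  rw [extChartAt_tangent_apply_self]
  exact differentiableAt_lagrangeExpr (differentiableAt_metricExpr m _)

/-- A form invariant under the tangent action induces an invariant form on a level of the
momentum. -/
theorem IsOneParameterGroup.isPreservedBy_tangentAction [FiniteDimensional ℝ E]
    (hγ : IsOneParameterGroup γ) (hm : ActsByIsometries G m) (k : ℝ) {j : ℕ}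
    {α : DiffForm (𝓘(ℝ, E).tangent) (TangentBundle 𝓘(ℝ, E) M) j} (h : G)
    (hα : pullbackForm (𝓘(ℝ, E).tangent) (𝓘(ℝ, E).tangent) (tangentAction E M h) α = α) :
    IsPreservedBy (𝓘(ℝ, E).tangent) (momentum m γ) k
      (inducedForm (𝓘(ℝ, E).tangent) (momentum m γ) k α) (tangentAction E M h) := by
  intro w
  have hJ : momentum m γ ∘ tangentAction E M h = momentum m γ :=
    funext (hγ.momentum_tangentAction hm h)
  have e1 := mfderiv_comp w.1 (((hγ.contMDiff_momentum m).mdifferentiable (by simp))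
    (tangentAction E M h w.1)) ((contMDiff_tangentAction h).mdifferentiable (by simp) w.1)
  refine ⟨(hγ.momentum_tangentAction hm h w.1).trans w.2, fun Y hY => ?_, ?_⟩
  · rw [hJ] at e1
    have h2 : mfderiv (𝓘(ℝ, E).tangent) 𝓘(ℝ, ℝ) (momentum m γ) w.1 Y = 0 := hY
    exact (congrArg (fun L : E × E →L[ℝ] ℝ => L Y) e1).symm.trans h2
  · ext Y
    exact congrArg (fun β : (E × E) [⋀^Fin j]→L[ℝ] ℝ => β fun i => (Y i).1)
      (congrFun hα w.1)

end Invariance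

/-! ### Regularity of the levels and horizontality. -/

section Horizontal

variable {E : Type*} [NormedAddCommGroup E] [NormedSpace ℝ E]
  {E' : Type*} [NormedAddCommGroup E'] [NormedSpace ℝ E']
  {M : Type*} [TopologicalSpace M] [ChartedSpace E M] [IsManifold 𝓘(ℝ, E) ∞ M]
  {M' : Type*} [TopologicalSpace M'] [ChartedSpace E' M'] [IsManifold 𝓘(ℝ, E') ∞ M']
  {G : Type*} [TopologicalSpace G] [ChartedSpace ℝ G] [Group G]
  [MulAction G M] [ContMDiffSMul 𝓘(ℝ, ℝ) 𝓘(ℝ, E) ∞ G M]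
  {γ : ℝ → G} {p : M → M'} {m : Metric E M}

theorem IsOneParameterGroup.eventually_fderiv_mapExpr_generatorExpr (hγ : IsOneParameterGroup γ)
    (hp : IsPrincipalBundle E E' G p) (x : M) :
    ∀ᶠ z in 𝓝 (extChartAt 𝓘(ℝ, E) x x),
      fderiv ℝ (mapExpr E E' p x) z (generatorExpr E γ x z) = 0 := by
  filter_upwards [eventually_mem_source hp.contMDiff x] with z hz
  rw [fderiv_mapExpr hp.contMDiff hz.1 hz.2, hγ.chartFrame_generatorExpr hz.1]
  have h := hγ.mfderiv_generator_eq_zero hp ((extChartAt 𝓘(ℝ, E) x).symm z)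
  let A : E' →L[ℝ] E' := mfderiv 𝓘(ℝ, E') 𝓘(ℝ, E') (extChartAt 𝓘(ℝ, E') (p x))
    (p ((extChartAt 𝓘(ℝ, E) x).symm z))
  exact (congrArg A h).trans (_root_.map_zero A)

theorem IsOneParameterGroup.exists_eq_smul_generatorExpr
    (hγ : IsOneParameterGroup γ) (hp : IsPrincipalBundle E E' G p) (x : M) (a : E)
    (ha : fderiv ℝ (mapExpr E E' p x) (extChartAt 𝓘(ℝ, E) x x) a = 0) :
    ∃ c : ℝ, a = c • generatorExpr E γ x (extChartAt 𝓘(ℝ, E) x x) := by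
  rw [fderiv_mapExpr_self hp.contMDiff] at ha
  rw [hγ.generatorExpr_self]
  exact hγ.exists_eq_smul_generator hp x ha

theorem IsOneParameterGroup.metricExpr_generatorExpr_pos (hγ : IsOneParameterGroup γ)
    (hp : IsPrincipalBundle E E' G p) (m : Metric E M) (x : M) :
    0 < metricExpr m x (extChartAt 𝓘(ℝ, E) x x)
      (generatorExpr E γ x (extChartAt 𝓘(ℝ, E) x x))
      (generatorExpr E γ x (extChartAt 𝓘(ℝ, E) x x)) := by
  rw [metricExpr_self, hγ.generatorExpr_self]
  exact m.pos x _ (hγ.generator_ne_zero hp x)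

theorem IsOneParameterGroup.differentiableAt_generatorExpr (hγ : IsOneParameterGroup γ) (x : M) :
    DifferentiableAt ℝ (generatorExpr E γ x) (extChartAt 𝓘(ℝ, E) x x) :=
  (hγ.contDiffAt_generatorExpr (mem_extChartAt_target x)).differentiableAt (by simp)

theorem IsOneParameterGroup.momentum_eq (hγ : IsOneParameterGroup γ) (m : Metric E M)
    (w : TangentBundle 𝓘(ℝ, E) M) :
    momentum m γ w = metricExpr m w.proj (extChartAt 𝓘(ℝ, E) w.proj w.proj)
      (generatorExpr E γ w.proj (extChartAt 𝓘(ℝ, E) w.proj w.proj)) w.snd := by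
  have h := metricExpr_self m w.proj (generator (E := E) γ w.proj) w.snd
  rw [hγ.generatorExpr_self]
  exact h.symm

variable [FiniteDimensional ℝ E]

theorem IsOneParameterGroup.mfderiv_momentum_ne_zero (hγ : IsOneParameterGroup γ)
    (hp : IsPrincipalBundle E E' G p) (m : Metric E M) (w : TangentBundle 𝓘(ℝ, E) M) :
    mfderiv (𝓘(ℝ, E).tangent) 𝓘(ℝ, ℝ) (momentum m γ) w ≠ 0 := by
  obtain ⟨x, u'⟩ := w
  obtain ⟨u, rfl⟩ : ∃ u : E, u = u' := ⟨u', rfl⟩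
  intro h
  set V := generatorExpr E γ x
  set z := extChartAt 𝓘(ℝ, E) x x
  have h1 : fderiv ℝ (momentumExpr (metricExpr m x) V) (z, u) (0, V z) = 0 :=
    congrArg (fun L : E × E →L[ℝ] ℝ => L (0, V z)) ((hγ.mfderiv_momentum m ⟨x, u⟩).symm.trans h)
  rw [fderiv_momentumExpr_vertical (differentiableAt_metricExpr m x)
    (hγ.differentiableAt_generatorExpr x)] at h1
  exact (hγ.metricExpr_generatorExpr_pos hp m x).ne' h1

/-- A vector tangent to a level of the momentum and vertical for the tangent map of the bundle is a
multiple of the complete lift of the generating vector field. -/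
theorem IsOneParameterGroup.exists_of_levelDeriv_eq_zero
    (hγ : IsOneParameterGroup γ) (hp : IsPrincipalBundle E E' G p) {w : TangentBundle 𝓘(ℝ, E) M}
    (Y : levelTangent (𝓘(ℝ, E).tangent) (momentum m γ) w)
    (hY : levelDeriv (𝓘(ℝ, E).tangent) (𝓘(ℝ, E').tangent) (momentum m γ)
      (tangentMap 𝓘(ℝ, E) 𝓘(ℝ, E') p) w Y = 0) :
    ∃ c d : ℝ, (Y.1 : E × E) =
      (c • generatorExpr E γ w.proj (extChartAt 𝓘(ℝ, E) w.proj w.proj),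
        c • fderiv ℝ (generatorExpr E γ w.proj) (extChartAt 𝓘(ℝ, E) w.proj w.proj) w.snd
          + d • generatorExpr E γ w.proj (extChartAt 𝓘(ℝ, E) w.proj w.proj)) := by
  -- The coefficient `d` is left free here. `extDeriv_lagrangeExpr_completeLift` derives `d = 0`
  -- from tangency, and the one-form sees only the base component.
  refine exists_of_fderiv_tangentExpr_eq_zero (contDiffAt_mapExpr hp.contMDiff w.proj)
    (hγ.differentiableAt_generatorExpr w.proj)
    (hγ.eventually_fderiv_mapExpr_generatorExpr hp w.proj)
    (hγ.exists_eq_smul_generatorExpr hp w.proj) ?_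
  have h := mfderiv_tangentMap hp.contMDiff w
  exact (congrArg (fun L : E × E →L[ℝ] E' × E' => L Y.1) h).symm.trans hY

theorem IsOneParameterGroup.fderiv_momentumExpr_eq_zero (hγ : IsOneParameterGroup γ)
    {w : TangentBundle 𝓘(ℝ, E) M}
    (Y : levelTangent (𝓘(ℝ, E).tangent) (momentum m γ) w) :
    fderiv ℝ (momentumExpr (metricExpr m w.proj) (generatorExpr E γ w.proj))
      (extChartAt 𝓘(ℝ, E) w.proj w.proj, w.snd) Y.1 = 0 := by
  have h : mfderiv (𝓘(ℝ, E).tangent) 𝓘(ℝ, ℝ) (momentum m γ) w Y.1 = 0 := Y.2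
  exact (congrArg (fun L : E × E →L[ℝ] ℝ => L Y.1) (hγ.mfderiv_momentum m w)).symm.trans h

theorem IsOneParameterGroup.isHorizontal_lagrangeTwoForm
    (hγ : IsOneParameterGroup γ) (hp : IsPrincipalBundle E E' G p)
    (hm : ActsByIsometries G m) (k : ℝ) :
    IsHorizontal (𝓘(ℝ, E).tangent) (𝓘(ℝ, E').tangent) (momentum m γ) k
      (inducedForm (𝓘(ℝ, E).tangent) (momentum m γ) k (lagrangeTwoForm m))
      (tangentMap 𝓘(ℝ, E) 𝓘(ℝ, E') p) := by
  have key : ∀ (w : Level (momentum m γ) k)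
      (Y : Fin 2 → levelTangent (𝓘(ℝ, E).tangent) (momentum m γ) w.1),
      levelDeriv (𝓘(ℝ, E).tangent) (𝓘(ℝ, E').tangent) (momentum m γ)
        (tangentMap 𝓘(ℝ, E) 𝓘(ℝ, E') p) w.1 (Y 0) = 0 →
      inducedForm (𝓘(ℝ, E).tangent) (momentum m γ) k (lagrangeTwoForm m) w Y = 0 := by
    rintro ⟨w, hw⟩ Y hY
    obtain ⟨c, d, hcd⟩ := hγ.exists_of_levelDeriv_eq_zero hp (Y 0) hY
    have h := extDeriv_lagrangeExpr_completeLift (Y := fun i => (Y i).1)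
      (differentiableAt_metricExpr m w.proj) (hγ.differentiableAt_generatorExpr w.proj)
      (Filter.Eventually.of_forall fun z a b => metricExpr_symm m w.proj z a b)
      (hγ.killing hm w.proj) hcd (hγ.metricExpr_generatorExpr_pos hp m w.proj).ne'
      (hγ.fderiv_momentumExpr_eq_zero (Y 0)) (hγ.fderiv_momentumExpr_eq_zero (Y 1))
    exact (congrArg (fun β : (E × E) [⋀^Fin 2]→L[ℝ] ℝ => β fun i => (Y i).1)
      (lagrangeTwoForm_eq m w)).trans h
  rintro w Y ⟨i, hi⟩
  fin_cases i
  · exact key w Y hi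
  -- A vertical second argument reduces to the first by antisymmetry.
  · have h1 := key w (Y ∘ Equiv.swap 0 1) (by simpa using hi)
    have h2 := (inducedForm (𝓘(ℝ, E).tangent) (momentum m γ) k
      (lagrangeTwoForm m) w).toAlternatingMap.map_swap Y (zero_ne_one (α := Fin 2))
    exact neg_eq_zero.1 (h2.symm.trans h1)

/-- The one-form takes the value `k` on the complete lift at every point of the level; a point of
`M` is needed to have a nonempty level to test on. -/
theorem IsOneParameterGroup.isHorizontal_lagrangeOneForm_iff [Nonempty M]
    (hγ : IsOneParameterGroup γ) (hp : IsPrincipalBundle E E' G p)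
    (hm : ActsByIsometries G m) (k : ℝ) :
    IsHorizontal (𝓘(ℝ, E).tangent) (𝓘(ℝ, E').tangent) (momentum m γ) k
      (inducedForm (𝓘(ℝ, E).tangent) (momentum m γ) k (lagrangeOneForm m))
      (tangentMap 𝓘(ℝ, E) 𝓘(ℝ, E') p) ↔ k = 0 := by
  constructor
  · intro hH
    obtain ⟨x⟩ := ‹Nonempty M›
    have hpos := hγ.metricExpr_generatorExpr_pos hp m x
    set z := extChartAt 𝓘(ℝ, E) x x with hz
    set V := generatorExpr E γ x with hV
    -- The multiple of `V` at which the momentum is exactly `k`.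
    set u : E := (k / metricExpr m x z (V z) (V z)) • V z with hu
    let w : TangentBundle 𝓘(ℝ, E) M := ⟨x, u⟩
    have hgk : metricExpr m x z (V z) u = k := by
      rw [hu, map_smul, smul_eq_mul, div_mul_cancel₀ _ hpos.ne']
    have hw : w ∈ Level (momentum m γ) k := (hγ.momentum_eq m w).trans hgk
    -- The complete lift of `V`: tangent to the level by the Killing equation, and killed by the
    -- tangent map of `Tp`.
    let Y : E × E := (V z, fderiv ℝ V z u)
    have hYJ : (mfderiv (𝓘(ℝ, E).tangent) 𝓘(ℝ, ℝ) (momentum m γ) w : E × E →L[ℝ] ℝ) Y = 0 := by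
      refine (congrArg (fun L : E × E →L[ℝ] ℝ => L Y) (hγ.mfderiv_momentum m w)).trans ?_
      exact (fderiv_momentumExpr_apply (q := (z, u)) (differentiableAt_metricExpr m x)
        (hγ.differentiableAt_generatorExpr x) Y).trans (hγ.killing hm x (V z) u)
    have hYT : (mfderiv (𝓘(ℝ, E).tangent) (𝓘(ℝ, E').tangent) (tangentMap 𝓘(ℝ, E) 𝓘(ℝ, E') p) w :
        E × E →L[ℝ] E' × E') Y = 0 :=
      (congrArg (fun L : E × E →L[ℝ] E' × E' => L Y) (mfderiv_tangentMap hp.contMDiff w)).trans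
        (fderiv_tangentExpr_completeLift (contDiffAt_mapExpr hp.contMDiff x)
          (hγ.differentiableAt_generatorExpr x)
          (hγ.eventually_fderiv_mapExpr_generatorExpr hp x) u)
    have h0 := hH ⟨w, hw⟩ (fun _ => ⟨Y, hYJ⟩) ⟨0, hYT⟩
    have h1 : metricExpr m x z u (V z) = 0 :=
      (lagrangeOneForm_apply m w (fun _ => Y)).symm.trans h0
    rw [← hgk, metricExpr_symm, h1]
  · rintro rfl ⟨w, hw⟩ Y ⟨i, hi⟩
    obtain rfl : i = 0 := Subsingleton.elim _ _
    obtain ⟨c, d, hcd⟩ := hγ.exists_of_levelDeriv_eq_zero hp (Y 0) hi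
    refine (lagrangeOneForm_apply m w (fun i => (Y i).1)).trans ?_
    have h1 := (hγ.momentum_eq m w).symm.trans hw
    have h2 := congrArg Prod.fst hcd
    refine (congrArg _ h2).trans ?_
    dsimp only
    rw [map_smul]
    exact (congrArg (c • ·) ((metricExpr_symm m w.proj _ _ _).trans h1)).trans (smul_zero c)

end Horizontal

end MomentumLevel

end

theorem theorem3
    {E : Type*} [NormedAddCommGroup E] [NormedSpace ℝ E] [FiniteDimensional ℝ E]
    {E' : Type*} [NormedAddCommGroup E'] [NormedSpace ℝ E'] [FiniteDimensional ℝ E']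
    {M : Type*} [TopologicalSpace M] [ChartedSpace E M] [IsManifold 𝓘(ℝ, E) ∞ M] [Nonempty M]
    {M' : Type*} [TopologicalSpace M'] [ChartedSpace E' M'] [IsManifold 𝓘(ℝ, E') ∞ M']
    {G : Type*} [TopologicalSpace G] [ChartedSpace ℝ G] [Group G] [LieGroup 𝓘(ℝ, ℝ) ∞ G]
    [MulAction G M] [ContMDiffSMul 𝓘(ℝ, ℝ) 𝓘(ℝ, E) ∞ G M]
    (γ : ℝ → G) (hγ : MomentumLevel.IsOneParameterGroup γ)
    (p : M → M') (hp : MomentumLevel.IsPrincipalBundle E E' G p)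
    (m : MomentumLevel.Metric E M) (hm : MomentumLevel.ActsByIsometries G m)
    (k : ℝ)
    -- the momentum, and the forms induced on its level `k` by the Lagrange forms
    (J : TangentBundle 𝓘(ℝ, E) M → ℝ) (hJ : J = MomentumLevel.momentum m γ)
    (θk : MomentumLevel.LevelForm (𝓘(ℝ, E).tangent) J k 1)
    (hθk : θk = MomentumLevel.inducedForm (𝓘(ℝ, E).tangent) J k
      (MomentumLevel.lagrangeOneForm m))
    (σk : MomentumLevel.LevelForm (𝓘(ℝ, E).tangent) J k 2)
    (hσk : σk = MomentumLevel.inducedForm (𝓘(ℝ, E).tangent) J k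
      (MomentumLevel.lagrangeTwoForm m)) :
    -- the level is regular, so that its tangent spaces are the kernels of `dJ`
    (ContMDiff (𝓘(ℝ, E).tangent) 𝓘(ℝ, ℝ) ∞ J ∧
      ∀ w, mfderiv (𝓘(ℝ, E).tangent) 𝓘(ℝ, ℝ) J w ≠ 0) ∧
    -- both forms are preserved by the group of the tangent maps of the `h ∈ G`
    (∀ h : G, MomentumLevel.IsPreservedBy (𝓘(ℝ, E).tangent) J k θk
      (MomentumLevel.tangentAction E M h)) ∧
    (∀ h : G, MomentumLevel.IsPreservedBy (𝓘(ℝ, E).tangent) J k σk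
      (MomentumLevel.tangentAction E M h)) ∧
    -- horizontality for the bundle `J_k → TM'`, the restriction of `Tp : TM → TM'`
    MomentumLevel.IsHorizontal (𝓘(ℝ, E).tangent) (𝓘(ℝ, E').tangent) J k σk
      (tangentMap 𝓘(ℝ, E) 𝓘(ℝ, E') p) ∧
    (MomentumLevel.IsHorizontal (𝓘(ℝ, E).tangent) (𝓘(ℝ, E').tangent) J k θk
      (tangentMap 𝓘(ℝ, E) 𝓘(ℝ, E') p) ↔ k = 0) := by
  subst hJ hθk hσk
  exact ⟨⟨hγ.contMDiff_momentum m, hγ.mfderiv_momentum_ne_zero hp m⟩,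
    fun h => hγ.isPreservedBy_tangentAction hm k h
      (MomentumLevel.pullbackForm_lagrangeOneForm hm h),
    fun h => hγ.isPreservedBy_tangentAction hm k h
      (MomentumLevel.pullbackForm_lagrangeTwoForm hm h),
    hγ.isHorizontal_lagrangeTwoForm hp hm k, hγ.isHorizontal_lagrangeOneForm_iff hp hm k⟩
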